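/- Consider the fully dynamic Boolean matrix closure problem: maintain an $n\times n$ Boolean matrix $X$ ($n\ge 1$, initially $X=0$; equivalently, a digraph on $n$ vertices with adjacency matrix $X$) under any sequence of the operations - $\mathrm{Init}^*(Y)$: $X\leftarrow Y$, for a Boolean matrix $Y$; - $\mathrm{Set}^*(i,\Delta X)$: set to $1$ the entries of $X$ in the $i$-th row and the $i$-th column at which $\Delta X$ is $1$; - $\mathrm{Reset}^*(\Delta X)$, where $\Delta X\subseteq X$ is given as a list of the positions of its ones: set these entries of $X$ to $0$; - $\mathrm{Lookup}^*(x,y)$: return $X^*[x,y]$, where $X^*$ is the Kleene closure (reflexive transitive closure) of $X$. There is a deterministic data structure for this problem, i.e. a fixed program for each type of operation on a word RAM with words of $w\ge k\log_2(n+2)$ bits ($k$ an absolute constant) and unit-cost instructions, such that: 1. on every sequence of operations all operations terminate, every $\mathrm{Lookup}^*$ is answered correctly, and every $\mathrm{Lookup}^*$ takes $O(1)$ worst-case time; 2. if at least $\Omega(n^2)$ $\mathrm{Reset}^*$ operations are performed per $\mathrm{Init}^*$ operation and no $\mathrm{Set}^*$ operation is performed, then the amortized cost of $\mathrm{Reset}^*$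 is $O(n)$ per operation, even when the time of the $\mathrm{Init}^*$ operations is charged to the $\mathrm{Reset}^*$ operations. Precisely: for every $c>0$ there is a constant $C$, depending only on $c$, such that for all $n\ge1$, all such $w$ and every sequence containing no $\mathrm{Set}^*$, $I$ operations $\mathrm{Init}^*$ and $R$ operations $\mathrm{Reset}^*$ with $R\ge c\,n^2 I$ (and any number of $\mathrm{Lookup}^*$), the total time of all $\mathrm{Init}^*$ and $\mathrm{Reset}^*$ operations is at most $C\,n\,R$. -/

import Mathlib

namespace DynClosure

/-! ## A deterministic word RAM

A program is a finite piece of syntax, fixed once and for all (in particular, independent of the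
problem size).  It works on finitely many scalar variables and finitely many arrays, all of whose
cells hold `w`-bit words; arithmetic is carried out modulo `2 ^ w`.  An additional read-only array
holds the arguments of the operation that is being executed. -/

/-- Expressions. -/
inductive Expr : Type
  | lit (c : ℕ)
  | var (x : ℕ)
  | read (a : ℕ) (i : Expr)
  | input (i : Expr)
  | add (e f : Expr)
  | sub (e f : Expr)
  | mul (e f : Expr)
  | div (e f : Expr)
  | mod (e f : Expr)
  | lt (e f : Expr)
  | eq (e f : Expr)

/-- Statements: `assign x e` is `x := e`, and `write a i e` is `a[i] := e`. -/
inductive Stmt : Type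
  | skip
  | assign (x : ℕ) (e : Expr)
  | write (a : ℕ) (i e : Expr)
  | seq (p q : Stmt)
  | cond (e : Expr) (p q : Stmt)
  | loop (e : Expr) (p : Stmt)

/-- The contents of the scalar variables and of the arrays. -/
structure Store where
  var : ℕ → ℕ
  arr : ℕ → ℕ → ℕ

/-- All of the memory is initially zero. -/
def Store.zero : Store := ⟨fun _ => 0, fun _ _ => 0⟩

def Store.setVar (s : Store) (x v : ℕ) : Store :=
  ⟨Function.update s.var x v, s.arr⟩

def Store.setArr (s : Store) (a i v : ℕ) : Store :=
  ⟨s.var, Function.update s.arr a (Function.update (s.arr a) i v)⟩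

/-- The value of an expression on `w`-bit words, with arguments `inp` and memory `s`.
Subtraction is truncated at zero; a comparison yields `1` or `0`. -/
def Expr.eval (w : ℕ) (inp : List ℕ) (s : Store) : Expr → ℕ
  | .lit c => c % 2 ^ w
  | .var x => s.var x
  | .read a i => s.arr a (i.eval w inp s)
  | .input i => inp.getD (i.eval w inp s) 0 % 2 ^ w
  | .add e f => (e.eval w inp s + f.eval w inp s) % 2 ^ w
  | .sub e f => e.eval w inp s - f.eval w inp s
  | .mul e f => (e.eval w inp s * f.eval w inp s) % 2 ^ w
  | .div e f => e.eval w inp s / f.eval w inp s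
  | .mod e f => e.eval w inp s % f.eval w inp s
  | .lt e f => if e.eval w inp s < f.eval w inp s then 1 else 0
  | .eq e f => if e.eval w inp s = f.eval w inp s then 1 else 0

/-- Every constant, variable access, array access and arithmetic operation takes unit time. -/
def Expr.cost : Expr → ℕ
  | .lit _ => 1
  | .var _ => 1
  | .read _ i => i.cost + 1
  | .input i => i.cost + 1
  | .add e f => e.cost + f.cost + 1
  | .sub e f => e.cost + f.cost + 1
  | .mul e f => e.cost + f.cost + 1
  | .div e f => e.cost + f.cost + 1
  | .mod e f => e.cost + f.cost + 1
  | .lt e f => e.cost + f.cost + 1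
  | .eq e f => e.cost + f.cost + 1

/-- `Exec w inp p s s' t`: the program `p`, started with memory `s`, halts with memory `s'` after
exactly `t` steps.  In tests, nonzero means true. -/
inductive Exec (w : ℕ) (inp : List ℕ) : Stmt → Store → Store → ℕ → Prop
  | skip (s : Store) : Exec w inp .skip s s 1
  | assign (x : ℕ) (e : Expr) (s : Store) :
      Exec w inp (.assign x e) s (s.setVar x (e.eval w inp s)) (e.cost + 1)
  | write (a : ℕ) (i e : Expr) (s : Store) :
      Exec w inp (.write a i e) s (s.setArr a (i.eval w inp s) (e.eval w inp s))
        (i.cost + e.cost + 1)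
  | seq {p q : Stmt} {s s' s'' : Store} {t t' : ℕ} :
      Exec w inp p s s' t → Exec w inp q s' s'' t' → Exec w inp (.seq p q) s s'' (t + t')
  | condTrue {e : Expr} {p q : Stmt} {s s' : Store} {t : ℕ} :
      e.eval w inp s ≠ 0 → Exec w inp p s s' t →
        Exec w inp (.cond e p q) s s' (e.cost + 1 + t)
  | condFalse {e : Expr} {p q : Stmt} {s s' : Store} {t : ℕ} :
      e.eval w inp s = 0 → Exec w inp q s s' t →
        Exec w inp (.cond e p q) s s' (e.cost + 1 + t)
  | loopTrue {e : Expr} {p : Stmt} {s s' s'' : Store} {t t' : ℕ} :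
      e.eval w inp s ≠ 0 → Exec w inp p s s' t → Exec w inp (.loop e p) s' s'' t' →
        Exec w inp (.loop e p) s s'' (e.cost + 1 + t + t')
  | loopFalse {e : Expr} {p : Stmt} {s : Store} :
      e.eval w inp s = 0 → Exec w inp (.loop e p) s s (e.cost + 1)

/-! ## The fully dynamic Boolean matrix closure problem -/

abbrev BMat (n : ℕ) : Type := Matrix (Fin n) (Fin n) Bool

/-- The operations `Init*(Y)`, `Set*(i, ΔX)`, `Reset*(ΔX)` and `Lookup*(x, y)`.  The update matrix
of `Reset*` is given by the list of the positions of its ones, in any order. -/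
inductive Op (n : ℕ) : Type
  | initOp (Y : BMat n)
  | setOp (i : Fin n) (D : BMat n)
  | resetOp (D : List (Fin n × Fin n))
  | lookupOp (x y : Fin n)

namespace Op

variable {n : ℕ}

def isInit : Op n → Bool
  | initOp _ => true
  | _ => false

def isSet : Op n → Bool
  | setOp _ _ => true
  | _ => false

def isReset : Op n → Bool
  | resetOp _ => true
  | _ => false

def isLookup : Op n → Bool
  | lookupOp _ _ => true
  | _ => false

/-- The effect of an operation on the matrix `X`; for `Set*(i, ΔX)` only the `i`-th row and the
`i`-th column of `ΔX` are inserted. -/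
def apply (X : BMat n) : Op n → BMat n
  | initOp Y => Y
  | setOp i D => Matrix.of fun x y => X x y || (D x y && (decide (x = i) || decide (y = i)))
  | resetOp D => Matrix.of fun x y => X x y && !decide ((x, y) ∈ D)
  | lookupOp _ _ => X

/-- The entries of a matrix in row-major order. -/
def rowMajor (Y : BMat n) : List ℕ :=
  List.ofFn fun q : Fin (n * n) => (Y q.divNat q.modNat).toNat

/-- The arguments of an operation as they are presented to the program (indices from `0`). -/
def args : Op n → List ℕ
  | initOp Y => n :: rowMajor Y
  | setOp i D => n :: (i : ℕ) :: rowMajor D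
  | resetOp D => n :: D.length :: D.flatMap fun p => [(p.1 : ℕ), (p.2 : ℕ)]
  | lookupOp x y => [n, (x : ℕ), (y : ℕ)]

end Op

/-- The value of `X` after a sequence of operations; at time `0` it is the zero matrix. -/
def matrixAfter {n : ℕ} (σ : List (Op n)) : BMat n :=
  σ.foldl Op.apply (Matrix.of fun _ _ => false)

/-- Each `Reset*(ΔX)` satisfies `ΔX ⊆ X` at its time, and lists every one of `ΔX` once. -/
def Legal {n : ℕ} (σ : List (Op n)) : Prop :=
  ∀ (j : ℕ) (D : List (Fin n × Fin n)), σ[j]? = some (.resetOp D) →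
    D.Nodup ∧ ∀ p ∈ D, matrixAfter (σ.take j) p.1 p.2 = true

/-- `X*[x, y] = 1`, where `X*` is the Kleene closure, i.e. the reflexive transitive closure of the
digraph with adjacency matrix `X`. -/
def InClosure {n : ℕ} (X : BMat n) (x y : Fin n) : Prop :=
  Relation.ReflTransGen (fun a b => X a b = true) x y

/-! ## Data structures for the problem -/

/-- One program for each type of operation; the memory is kept between operations. -/
structure DataStructure where
  initCode : Stmt
  setCode : Stmt
  resetCode : Stmt
  lookupCode : Stmt

def DataStructure.code (P : DataStructure) {n : ℕ} : Op n → Stmt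
  | .initOp _ => P.initCode
  | .setOp _ _ => P.setCode
  | .resetOp _ => P.resetCode
  | .lookupOp _ _ => P.lookupCode

/-- `Run P w s σ r`: executing the sequence `σ` from memory `s` on `w`-bit words, every operation
halts, and `r` lists for each operation its running time and the value it returns, which is the
value left in variable `0`. -/
inductive Run (P : DataStructure) (w : ℕ) {n : ℕ} :
    Store → List (Op n) → List (ℕ × ℕ) → Prop
  | nil (s : Store) : Run P w s [] []
  | cons {s s' : Store} {o : Op n} {σ : List (Op n)} {t : ℕ} {r : List (ℕ × ℕ)} :
      Exec w o.args (P.code o) s s' t → Run P w s' σ r →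
        Run P w s (o :: σ) ((t, s'.var 0) :: r)

/-- The total time of all operations of a run other than `Lookup*`. -/
def updateTime {n : ℕ} (σ : List (Op n)) (r : List (ℕ × ℕ)) : ℕ :=
  ((σ.zip r).map fun p => if p.1.isLookup then 0 else p.2.1).sum

end DynClosure

/-!
The data structure maintains all stages of Warshall's algorithm.  Let `W 0 = X` and let
`W (k + 1) i j = W k i j ∨ (W k i k ∧ W k k j)`; then `W n` together with the diagonal is the
closure of `X` (`closure_iff`), so that a query reads one entry.  The `n + 1` matrices are stored
at the addresses `addr n k i j`.

`Init*` and `Set*` compute all of them from scratch in time `O(n ^ 3)` (`loadCode_spec`).  Under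
`Reset*` every stored entry can only change from true to false.  An entry that has been cleared is
put on a stack; when the entry `(i, j)` of `W k` is taken off, the entry `(i, j)` of `W (k + 1)` is
recomputed, and, only if `i = k` or `j = k`, also the whole row `i` and column `j`, because no other
entry depends on it.  The invariant `Inv` says that a true entry without support has a dependency
on the stack, hence nothing is wrong once the stack is empty (`drainCode_spec`).

For the time, each of the `n + 1` matrices has `n ^ 2` entries processed in time `O(1)`, except for
the `2 * n` entries in row `k` and column `k`, which take time `O(n)`.  So all deletions that can
follow one `Init*` cost `O(n ^ 3)` in total (`sum_entryCost_le`).  This sum, over the entries that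
are still true, serves as a potential: a `Reset*` costs `O(1)` beyond its decrease (`resetOp_spec`),
and an `Init*` raises it by `O(n ^ 3)` (`run_time`).  With `R ≥ c * n ^ 2 * I` the total
`O(n ^ 3 * I + R)` is `O(n * R)`.
-/

namespace DynClosure

/-! ### Addresses -/

/-- The address of the entry `(i, j)` of the `k`-th Warshall matrix, for `i, j < n` and `k ≤ n`. -/
def addr (n k i j : ℕ) : ℕ := (k * n + i) * n + j

/-- The number of addresses in use: `n + 1` matrices with `n * n` entries each. -/
def size (n : ℕ) : ℕ := (n + 1) * n * n

theorem addr_div {n k i j : ℕ} (hi : i < n) (hj : j < n) : addr n k i j / (n * n) = k := by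
  have hn : 0 < n := by omega
  rw [addr, ← Nat.div_div_eq_div_mul, Nat.mul_comm _ n, Nat.mul_add_div hn, Nat.div_eq_of_lt hj,
    Nat.add_zero, Nat.mul_comm k n, Nat.mul_add_div hn, Nat.div_eq_of_lt hi, Nat.add_zero]

theorem addr_div_mod {n k i j : ℕ} (hi : i < n) (hj : j < n) : addr n k i j / n % n = i := by
  have hn : 0 < n := by omega
  rw [addr, Nat.mul_comm _ n, Nat.mul_add_div hn, Nat.div_eq_of_lt hj,
    Nat.add_zero, Nat.mul_comm k n, Nat.mul_add_mod, Nat.mod_eq_of_lt hi]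

theorem addr_mod {n k i j : ℕ} (hj : j < n) : addr n k i j % n = j := by
  rw [addr, Nat.mul_comm _ n, Nat.mul_add_mod, Nat.mod_eq_of_lt hj]

theorem addr_decode (n a : ℕ) : addr n (a / (n * n)) (a / n % n) (a % n) = a := by
  rw [addr, ← Nat.div_div_eq_div_mul, Nat.div_add_mod', Nat.div_add_mod']

theorem addr_inj {n k i j k' i' j' : ℕ} (hi : i < n) (hj : j < n) (hi' : i' < n) (hj' : j' < n)
    (h : addr n k i j = addr n k' i' j') : k = k' ∧ i = i' ∧ j = j' :=
  ⟨by rw [← addr_div (k := k) hi hj, h, addr_div hi' hj'],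
    by rw [← addr_div_mod (k := k) hi hj, h, addr_div_mod hi' hj'],
    by rw [← addr_mod (k := k) (i := i) hj, h, addr_mod hj']⟩

theorem addr_lt_mul {n k i j : ℕ} (hi : i < n) (hj : j < n) : addr n k i j < (k + 1) * (n * n) := by
  unfold addr; nlinarith

theorem mul_le_addr (n k i j : ℕ) : k * (n * n) ≤ addr n k i j := by
  unfold addr; nlinarith

theorem addr_lt_size {n k i j : ℕ} (hk : k ≤ n) (hi : i < n) (hj : j < n) :
    addr n k i j < size n := by
  refine (addr_lt_mul hi hj).trans_le ?_
  rw [size, mul_assoc]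
  gcongr

theorem div_le_of_lt_size {n a : ℕ} (h : a < size n) : a / (n * n) ≤ n := by
  refine Nat.lt_succ_iff.1 (Nat.div_lt_of_lt_mul ?_)
  rw [size, mul_assoc] at h
  rwa [mul_comm]

/-! ### The stored matrices and the work list -/

/-- The part of the memory on which the algorithm works: the values at all addresses, and a stack
of the addresses that have been cleared but not yet processed. -/
structure Work where
  val : ℕ → ℕ
  stack : ℕ → ℕ
  top : ℕ

/-- Warshall's recurrence: the `k`-th matrix makes the entry `(i, j)` of the next one true. -/
def Support (n : ℕ) (g : ℕ → ℕ) (k i j : ℕ) : Prop :=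
  g (addr n k i j) ≠ 0 ∨ (g (addr n k i k) ≠ 0 ∧ g (addr n k k j) ≠ 0)

/-- Clear the entry at address `a`, and record it on the stack. -/
def Work.clear (m : Work) (a : ℕ) : Work :=
  ⟨Function.update m.val a 0, Function.update m.stack m.top a, m.top + 1⟩

open Classical in
/-- Clear the entry `(i, j)` of the matrix number `k + 1` if it has lost its support. -/
noncomputable def Work.recheck (n k i j : ℕ) (m : Work) : Work :=
  if m.val (addr n (k + 1) i j) ≠ 0 ∧ ¬ Support n m.val k i j
    then m.clear (addr n (k + 1) i j) else m

/-- The address `a` is on the stack. -/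
def Work.Pending (m : Work) (a : ℕ) : Prop := ∃ t < m.top, m.stack t = a

/-- A weighted count of the nonzero values (weight `u`) and of the stack entries (weight `v`). -/
def Work.pot (n : ℕ) (u v : ℕ → ℕ) (m : Work) : ℕ :=
  ∑ a ∈ Finset.range (size n), m.val a * u a + ∑ t ∈ Finset.range m.top, v (m.stack t)

/-- The invariant of the algorithm for the matrix `X`.  An entry of the matrix number `k + 1` may
be true without being supported by the `k`-th matrix only if one of the entries that it depends on
is still on the stack, or if it belongs to the set `E`. -/
structure Inv {n : ℕ} (X : BMat n) (E : ℕ → ℕ → ℕ → Prop) (m : Work) : Prop where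
  le_one : ∀ a < size n, m.val a ≤ 1
  count : m.pot n (fun _ => 1) (fun _ => 1) ≤ size n
  stack_lt : ∀ t < m.top, m.stack t < size n
  base : ∀ i j : Fin n, m.val (addr n 0 i j) = (X i j).toNat
  upper : ∀ k < n, ∀ i < n, ∀ j < n, Support n m.val k i j → m.val (addr n (k + 1) i j) ≠ 0
  lower : ∀ k < n, ∀ i < n, ∀ j < n, m.val (addr n (k + 1) i j) ≠ 0 → Support n m.val k i j ∨
    (m.Pending (addr n k i j) ∨ m.Pending (addr n k i k) ∨ m.Pending (addr n k k j)) ∨ E k i j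

theorem Inv.mono {n : ℕ} {X : BMat n} {E E' : ℕ → ℕ → ℕ → Prop} {m : Work} (h : Inv X E m)
    (hE : ∀ k < n, ∀ i < n, ∀ j < n, E k i j → E' k i j) : Inv X E' m :=
  { h with
    lower := fun k hk i hi j hj h0 =>
      (h.lower k hk i hi j hj h0).imp_right (Or.imp_right (hE k hk i hi j hj)) }

theorem Work.pot_clear {n : ℕ} (u v : ℕ → ℕ) {m : Work} {a : ℕ} (ha : a < size n)
    (h1 : m.val a = 1) : (m.clear a).pot n u v + u a = m.pot n u v + v a := by
  have hmem : a ∈ Finset.range (size n) := Finset.mem_range.2 ha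
  have e1 : ∑ b ∈ Finset.range (size n), m.val b * u b
      = u a + ∑ b ∈ (Finset.range (size n)).erase a, m.val b * u b := by
    rw [← Finset.add_sum_erase _ _ hmem, h1, one_mul]
  have e2 : ∑ b ∈ Finset.range (size n), (m.clear a).val b * u b
      = ∑ b ∈ (Finset.range (size n)).erase a, m.val b * u b := by
    rw [← Finset.add_sum_erase _ _ hmem]
    simp only [Work.clear, Function.update_self, zero_mul, zero_add]
    refine Finset.sum_congr rfl fun b hb => ?_
    rw [Function.update_of_ne (Finset.ne_of_mem_erase hb)]
  have e3 : ∑ t ∈ Finset.range (m.clear a).top, v ((m.clear a).stack t)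
      = ∑ t ∈ Finset.range m.top, v (m.stack t) + v a := by
    simp only [Work.clear, Finset.sum_range_succ, Function.update_self]
    congr 1
    refine Finset.sum_congr rfl fun t ht => ?_
    rw [Function.update_of_ne (Finset.mem_range.1 ht).ne]
  unfold Work.pot
  rw [e1, e2, e3]
  ring

theorem Work.pending_clear {m : Work} {a b : ℕ} (h : m.Pending b) : (m.clear a).Pending b := by
  obtain ⟨t, ht, rfl⟩ := h
  exact ⟨t, Nat.lt_succ_of_lt ht, Function.update_of_ne ht.ne _ _⟩

theorem Work.pending_clear_self (m : Work) (a : ℕ) : (m.clear a).Pending a :=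
  ⟨m.top, Nat.lt_succ_self _, Function.update_self _ _ _⟩

theorem Work.val_clear_ne_zero {m : Work} {a b : ℕ} (h : (m.clear a).val b ≠ 0) :
    m.val b ≠ 0 := by
  by_cases hb : b = a
  · subst hb; simp [Work.clear] at h
  · simpa [Work.clear, hb] using h

theorem Work.val_clear_or {m : Work} {a b : ℕ} (h : m.val b ≠ 0) :
    (m.clear a).val b ≠ 0 ∨ (m.clear a).Pending b := by
  by_cases hb : b = a
  · subst hb; exact Or.inr (m.pending_clear_self b)
  · left; simpa [Work.clear, hb] using h

theorem Inv.top_lt {n : ℕ} {X : BMat n} {E : ℕ → ℕ → ℕ → Prop} {m : Work} (h : Inv X E m)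
    {a : ℕ} (ha : a < size n) (h1 : m.val a = 1) : m.top + 1 ≤ size n := by
  have h2 := Work.pot_clear (fun _ => 1) (fun _ => 1) ha h1
  have h3 := h.count
  have h4 : (m.clear a).pot n (fun _ => 1) (fun _ => 1)
      = ∑ b ∈ Finset.range (size n), (m.clear a).val b * 1 + (m.top + 1) := by
    simp [Work.pot, Work.clear]
  omega

/-- Clearing an unsupported entry keeps the invariant, since everything that depends on it is now
excused by the stack. -/
theorem Inv.clear {n : ℕ} {X X' : BMat n} {E : ℕ → ℕ → ℕ → Prop} {m : Work} (h : Inv X E m)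
    {a : ℕ} (ha : a < size n) (h1 : m.val a = 1)
    (hs : ∀ k < n, ∀ i < n, ∀ j < n, a = addr n (k + 1) i j → ¬ Support n m.val k i j)
    (hX : ∀ i j : Fin n, (m.clear a).val (addr n 0 i j) = (X' i j).toNat) :
    Inv X' E (m.clear a) where
  le_one b hb := by
    by_cases hba : b = a
    · subst hba; simp [Work.clear]
    · simpa [Work.clear, hba] using h.le_one b hb
  count := by
    have := Work.pot_clear (fun _ => 1) (fun _ => 1) ha h1
    have := h.count
    omega
  stack_lt t ht := by
    by_cases hta : t = m.top
    · subst hta; simpa [Work.clear] using ha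
    · have : t < m.top := by simp only [Work.clear] at ht; omega
      simpa [Work.clear, hta] using h.stack_lt t this
  base := hX
  upper k hk i hi j hj hsup := by
    have hsup' : Support n m.val k i j :=
      hsup.imp Work.val_clear_ne_zero
        (And.imp Work.val_clear_ne_zero Work.val_clear_ne_zero)
    have hne : addr n (k + 1) i j ≠ a := fun e => hs k hk i hi j hj e.symm hsup'
    simpa [Work.clear, hne] using h.upper k hk i hi j hj hsup'
  lower k hk i hi j hj h0 := by
    rcases h.lower k hk i hi j hj (Work.val_clear_ne_zero h0) with (hp | ⟨hp, hq⟩) | hp | hp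
    · rcases Work.val_clear_or (a := a) hp with h' | h'
      · exact Or.inl (Or.inl h')
      · exact Or.inr (Or.inl (Or.inl h'))
    · rcases Work.val_clear_or (a := a) hp with h' | h'
      · rcases Work.val_clear_or (a := a) hq with h'' | h''
        · exact Or.inl (Or.inr ⟨h', h''⟩)
        · exact Or.inr (Or.inl (Or.inr (Or.inr h'')))
      · exact Or.inr (Or.inl (Or.inr (Or.inl h')))
    · exact Or.inr (Or.inl (hp.imp Work.pending_clear
        (Or.imp Work.pending_clear Work.pending_clear)))
    · exact Or.inr (Or.inr hp)

theorem Inv.recheck {n : ℕ} {X : BMat n} {E : ℕ → ℕ → ℕ → Prop} {m : Work} (h : Inv X E m)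
    {k i j : ℕ} (hk : k < n) (hi : i < n) (hj : j < n) :
    Inv X (fun k' i' j' => E k' i' j' ∧ ¬ (k' = k ∧ i' = i ∧ j' = j)) (m.recheck n k i j) := by
  have key : ∀ m' : Work, Inv X E m' →
      (m'.val (addr n (k + 1) i j) ≠ 0 → Support n m'.val k i j) →
      Inv X (fun k' i' j' => E k' i' j' ∧ ¬ (k' = k ∧ i' = i ∧ j' = j)) m' := by
    intro m' h' hok
    refine { h' with lower := fun k' hk' i' hi' j' hj' h0 => ?_ }
    by_cases he : k' = k ∧ i' = i ∧ j' = j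
    · obtain ⟨rfl, rfl, rfl⟩ := he
      exact Or.inl (hok h0)
    · exact (h'.lower k' hk' i' hi' j' hj' h0).imp_right (Or.imp_right fun e => ⟨e, he⟩)
  unfold Work.recheck
  have ha : addr n (k + 1) i j < size n := addr_lt_size hk hi hj
  split_ifs with hc
  · refine key _ (h.clear ha ?_ ?_ ?_) ?_
    · have := h.le_one _ ha
      have := hc.1
      omega
    · intro k' _ i' hi' j' hj' he
      obtain ⟨h1, rfl, rfl⟩ := addr_inj hi hj hi' hj' he
      obtain rfl : k = k' := by omega
      exact hc.2
    · intro i' j'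
      have : addr n 0 i' j' ≠ addr n (k + 1) i j := fun e => by
        have := (addr_inj i'.2 j'.2 hi hj e).1
        omega
      rw [← h.base]
      simp [Work.clear, this]
    · simp [Work.clear]
  · refine key _ h fun h0 => ?_
    by_contra hs
    exact hc ⟨h0, hs⟩

theorem Inv.pot_recheck_le {n : ℕ} {X : BMat n} {E : ℕ → ℕ → ℕ → Prop} {m : Work}
    (h : Inv X E m) {k i j : ℕ} (hk : k < n) (hi : i < n) (hj : j < n) {u v : ℕ → ℕ}
    (huv : ∀ a, v a ≤ u a) : (m.recheck n k i j).pot n u v ≤ m.pot n u v := by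
  unfold Work.recheck
  have ha : addr n (k + 1) i j < size n := addr_lt_size hk hi hj
  split_ifs with hc
  · have h1 : m.val (addr n (k + 1) i j) = 1 := by
      have := h.le_one _ ha
      have := hc.1
      omega
    have := Work.pot_clear u v ha h1
    have := huv (addr n (k + 1) i j)
    omega
  · exact le_rfl

/-- Remove the topmost entry of the stack. -/
def Work.pop (m : Work) : Work := ⟨m.val, m.stack, m.top - 1⟩

theorem Work.pot_pop (n : ℕ) (u v : ℕ → ℕ) {m : Work} (h : m.top ≠ 0) :
    m.pop.pot n u v + v (m.stack (m.top - 1)) = m.pot n u v := by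
  obtain ⟨t, ht⟩ := Nat.exists_eq_succ_of_ne_zero h
  simp only [Work.pot, Work.pop, ht, Nat.succ_eq_add_one, Nat.add_sub_cancel,
    Finset.sum_range_succ]
  ring

/-- Once the entry `(i, j)` of the `k`-th matrix is taken off the stack, the entries of the next
matrix that depend on it are no longer excused. -/
theorem Inv.pop {n : ℕ} {X : BMat n} {m : Work} (h : Inv X (fun _ _ _ => False) m)
    (h0 : m.top ≠ 0) {k i j : ℕ} (hi : i < n) (hj : j < n)
    (htop : m.stack (m.top - 1) = addr n k i j) :
    Inv X (fun k' i' j' => k' = k ∧ (i' = i ∧ j' = j ∨ (i' = i ∨ j' = j) ∧ (i = k ∨ j = k)))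
      m.pop where
  le_one := h.le_one
  count := by
    have := Work.pot_pop n (fun _ => 1) (fun _ => 1) h0
    have := h.count
    omega
  stack_lt t ht := h.stack_lt t (by simp only [Work.pop] at ht; omega)
  base := h.base
  upper := h.upper
  lower k' hk' i' hi' j' hj' hv := by
    have key : ∀ b, m.Pending b → m.pop.Pending b ∨ b = addr n k i j := by
      rintro b ⟨t, ht, rfl⟩
      by_cases htt : t = m.top - 1
      · right; rw [htt, htop]
      · exact Or.inl ⟨t, by simp only [Work.pop]; omega, rfl⟩
    rcases h.lower k' hk' i' hi' j' hj' hv with hp | (hp | hp | hp) | hp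
    · exact Or.inl hp
    · rcases key _ hp with hq | hq
      · exact Or.inr (Or.inl (Or.inl hq))
      · obtain ⟨rfl, rfl, rfl⟩ := addr_inj hi' hj' hi hj hq
        exact Or.inr (Or.inr ⟨rfl, Or.inl ⟨rfl, rfl⟩⟩)
    · rcases key _ hp with hq | hq
      · exact Or.inr (Or.inl (Or.inr (Or.inl hq)))
      · obtain ⟨rfl, rfl, h3⟩ := addr_inj hi' hk' hi hj hq
        exact Or.inr (Or.inr ⟨rfl, Or.inr ⟨Or.inl rfl, Or.inr h3.symm⟩⟩)
    · rcases key _ hp with hq | hq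
      · exact Or.inr (Or.inl (Or.inr (Or.inr hq)))
      · obtain ⟨rfl, h3, rfl⟩ := addr_inj hk' hj' hi hj hq
        exact Or.inr (Or.inr ⟨rfl, Or.inr ⟨Or.inr rfl, Or.inl h3.symm⟩⟩)
    · exact hp.elim

theorem Inv.clear_base {n : ℕ} {X : BMat n} {E : ℕ → ℕ → ℕ → Prop} {m : Work} (h : Inv X E m)
    {p : Fin n × Fin n} (hp : X p.1 p.2 = true) :
    Inv (Op.apply X (.resetOp [p])) E (m.clear (addr n 0 p.1 p.2)) := by
  refine h.clear (addr_lt_size (Nat.zero_le _) p.1.2 p.2.2) ?_ ?_ ?_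
  · rw [h.base, hp]; rfl
  · intro k _ i hi j hj he
    have := (addr_inj p.1.2 p.2.2 hi hj he).1
    omega
  · intro i j
    by_cases he : (i, j) = p
    · subst he; simp [Work.clear, Op.apply]
    · have : addr n 0 i j ≠ addr n 0 p.1 p.2 := fun e => by
        obtain ⟨-, h1, h2⟩ := addr_inj i.2 j.2 p.1.2 p.2.2 e
        exact he (Prod.ext (Fin.ext h1) (Fin.ext h2))
      simp [Work.clear, this, h.base, Op.apply, he]

/-! ### Warshall's theorem -/

theorem support_sound {n : ℕ} {X : BMat n} {g : ℕ → ℕ}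
    (base : ∀ i j : Fin n, g (addr n 0 i j) = (X i j).toNat)
    (step : ∀ k < n, ∀ i < n, ∀ j < n, g (addr n (k + 1) i j) ≠ 0 → Support n g k i j) :
    ∀ k ≤ n, ∀ i j : Fin n, g (addr n k i j) ≠ 0 → InClosure X i j := by
  intro k
  induction k with
  | zero =>
    intro _ i j h
    rw [base] at h
    refine Relation.ReflTransGen.single ?_
    cases hx : X i j <;> simp_all
  | succ k ih =>
    intro hk i j h
    rcases step k hk i i.2 j j.2 h with h | ⟨h1, h2⟩
    · exact ih (by omega) i j h
    · exact (ih (by omega) i ⟨k, hk⟩ h1).trans (ih (by omega) ⟨k, hk⟩ j h2)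

/-- The `k`-th matrix composes paths that meet in a vertex below `k`. -/
theorem support_trans {n : ℕ} {g : ℕ → ℕ}
    (up : ∀ k < n, ∀ i < n, ∀ j < n, Support n g k i j → g (addr n (k + 1) i j) ≠ 0)
    (low : ∀ k < n, ∀ i < n, ∀ j < n, g (addr n (k + 1) i j) ≠ 0 → Support n g k i j) :
    ∀ k ≤ n, ∀ m < k, ∀ i < n, ∀ j < n,
      g (addr n k i m) ≠ 0 → g (addr n k m j) ≠ 0 → g (addr n k i j) ≠ 0 := by
  intro k
  induction k with
  | zero => intro _ m hm; omega
  | succ k ih =>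
    intro hk m hm i hi j hj h1 h2
    have ih := ih (by omega)
    have hmn : m < n := by omega
    apply up k hk i hi j hj
    have h1 := low k hk i hi m hmn h1
    have h2 := low k hk m hmn j hj h2
    by_cases hmk : m = k
    · subst hmk
      exact Or.inr ⟨h1.elim id And.left, h2.elim id And.right⟩
    · have hmk : m < k := by omega
      rcases h1 with h1 | ⟨h1, h1'⟩
      · rcases h2 with h2 | ⟨h2, h2'⟩
        · exact Or.inl (ih m hmk i hi j hj h1 h2)
        · exact Or.inr ⟨ih m hmk i hi k hk h1 h2, h2'⟩
      · rcases h2 with h2 | ⟨h2, h2'⟩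
        · exact Or.inr ⟨h1, ih m hmk k hk j hj h1' h2⟩
        · exact Or.inr ⟨h1, h2'⟩

theorem closure_iff {n : ℕ} {X : BMat n} {m : Work} (h : Inv X (fun _ _ _ => False) m)
    (h0 : m.top = 0) (x y : Fin n) :
    InClosure X x y ↔ x = y ∨ m.val (addr n n x y) ≠ 0 := by
  have low : ∀ k < n, ∀ i < n, ∀ j < n,
      m.val (addr n (k + 1) i j) ≠ 0 → Support n m.val k i j := by
    intro k hk i hi j hj hv
    have := h.lower k hk i hi j hj hv
    simpa [Work.Pending, h0] using this
  constructor
  · intro hc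
    induction hc with
    | refl => exact Or.inl rfl
    | tail _ hbc ih =>
      rename_i b c _
      have hbc' : ∀ k ≤ n, m.val (addr n k b c) ≠ 0 := by
        intro k
        induction k with
        | zero => intro _; rw [h.base, hbc]; simp
        | succ k ihk =>
          intro hk
          exact h.upper k hk b b.2 c c.2 (Or.inl (ihk (by omega)))
      rcases ih with rfl | ih
      · exact Or.inr (hbc' n le_rfl)
      · exact Or.inr (support_trans h.upper low n le_rfl b b.2 x x.2 c c.2 ih (hbc' n le_rfl))
  · rintro (rfl | hv)
    · exact Relation.ReflTransGen.refl
    · exact support_sound h.base low n le_rfl x y hv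

/-! ### The total potential -/

/-- A bound for the time to process the address `b` of an entry `(i, j)` of the `k`-th matrix: all
of row `i` and of column `j` has to be inspected if `i = k` or `j = k`, and one entry otherwise. -/
def popCost (n b : ℕ) : ℕ :=
  300 + if b / n % n = b / (n * n) ∨ b % n = b / (n * n) then 300 * n else 0

/-- A nonzero value also pays for being put on the stack. -/
def entryCost (n b : ℕ) : ℕ := popCost n b + 100

theorem popCost_le_entryCost (n b : ℕ) : popCost n b ≤ entryCost n b := Nat.le_add_right _ _

theorem card_row_le {n : ℕ} (hn : 0 < n) :
    ((Finset.range (size n)).filter fun b => b / n % n = b / (n * n)).card ≤ (n + 1) * n := by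
  have hcard : (Finset.range (n + 1) ×ˢ Finset.range n).card = (n + 1) * n := by simp
  rw [← hcard]
  refine Finset.card_le_card_of_injOn (fun b => (b / (n * n), b % n)) ?_ ?_
  · intro b hb
    have hb := (Finset.mem_filter.1 hb).1
    have := div_le_of_lt_size (Finset.mem_range.1 hb)
    have := Nat.mod_lt b hn
    simp only [Finset.coe_product, Set.mem_prod, Finset.mem_coe, Finset.mem_range]
    omega
  · intro b hb c hc he
    have hb := (Finset.mem_filter.1 hb).2
    have hc := (Finset.mem_filter.1 hc).2
    obtain ⟨h1, h2⟩ := Prod.mk.inj he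
    rw [← addr_decode n b, ← addr_decode n c, hb, hc, h1, h2]

theorem card_col_le {n : ℕ} (hn : 0 < n) :
    ((Finset.range (size n)).filter fun b => b % n = b / (n * n)).card ≤ (n + 1) * n := by
  have hcard : (Finset.range (n + 1) ×ˢ Finset.range n).card = (n + 1) * n := by simp
  rw [← hcard]
  refine Finset.card_le_card_of_injOn (fun b => (b / (n * n), b / n % n)) ?_ ?_
  · intro b hb
    have hb := (Finset.mem_filter.1 hb).1
    have := div_le_of_lt_size (Finset.mem_range.1 hb)
    have := Nat.mod_lt (b / n) hn
    simp only [Finset.coe_product, Set.mem_prod, Finset.mem_coe, Finset.mem_range]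
    omega
  · intro b hb c hc he
    have hb := (Finset.mem_filter.1 hb).2
    have hc := (Finset.mem_filter.1 hc).2
    obtain ⟨h1, h2⟩ := Prod.mk.inj he
    rw [← addr_decode n b, ← addr_decode n c, hb, hc, h1, h2]

/-- Among the `(n + 1) * n ^ 2` entries only `O(n ^ 2)` are expensive, each of cost `O(n)`. -/
theorem sum_entryCost_le {n : ℕ} (hn : 0 < n) :
    ∑ b ∈ Finset.range (size n), entryCost n b ≤ 1000 * size n := by
  have h : ∀ b ∈ Finset.range (size n), entryCost n b ≤ 400
      + ((if b / n % n = b / (n * n) then 300 * n else 0)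
        + (if b % n = b / (n * n) then 300 * n else 0)) := by
    intro b _
    unfold entryCost popCost
    split_ifs <;> omega
  refine (Finset.sum_le_sum h).trans ?_
  rw [Finset.sum_add_distrib, Finset.sum_add_distrib, ← Finset.sum_filter, ← Finset.sum_filter,
    Finset.sum_const, Finset.sum_const, Finset.sum_const, Finset.card_range]
  simp only [smul_eq_mul]
  have h1 := Nat.mul_le_mul_right (300 * n) (card_row_le hn)
  have h2 := Nat.mul_le_mul_right (300 * n) (card_col_le hn)
  unfold size at *
  nlinarith

/-- The potential of the amortized analysis. -/
def Work.potential (n : ℕ) (m : Work) : ℕ := m.pot n (entryCost n) (popCost n)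

theorem Inv.potential_le {n : ℕ} {X : BMat n} {E : ℕ → ℕ → ℕ → Prop} {m : Work} (h : Inv X E m)
    (hn : 0 < n) (h0 : m.top = 0) : m.potential n ≤ 1000 * size n := by
  refine le_trans ?_ (sum_entryCost_le hn)
  simp only [Work.potential, Work.pot, h0, Finset.range_zero, Finset.sum_empty, Nat.add_zero]
  refine Finset.sum_le_sum fun a ha => ?_
  have := h.le_one a (Finset.mem_range.1 ha)
  nlinarith

/-! ### Rules for halting programs -/

variable {w : ℕ} {inp : List ℕ}

theorem Exec.det {p : Stmt} {s s₁ s₂ : Store} {t₁ t₂ : ℕ} (h₁ : Exec w inp p s s₁ t₁)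
    (h₂ : Exec w inp p s s₂ t₂) : s₁ = s₂ ∧ t₁ = t₂ := by
  induction h₁ generalizing s₂ t₂ with
  | skip | assign | write => cases h₂; exact ⟨rfl, rfl⟩
  | seq _ _ ih ih' =>
    cases h₂ with
    | seq ha hb =>
      obtain ⟨rfl, rfl⟩ := ih ha
      obtain ⟨rfl, rfl⟩ := ih' hb
      exact ⟨rfl, rfl⟩
  | condTrue he _ ih =>
    cases h₂ with
    | condTrue _ ha => obtain ⟨rfl, rfl⟩ := ih ha; exact ⟨rfl, rfl⟩
    | condFalse he' _ => exact absurd he' he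
  | condFalse he _ ih =>
    cases h₂ with
    | condFalse _ ha => obtain ⟨rfl, rfl⟩ := ih ha; exact ⟨rfl, rfl⟩
    | condTrue he' _ => exact absurd he he'
  | loopTrue he _ _ ih ih' =>
    cases h₂ with
    | loopTrue _ ha hb =>
      obtain ⟨rfl, rfl⟩ := ih ha
      obtain ⟨rfl, rfl⟩ := ih' hb
      exact ⟨rfl, rfl⟩
    | loopFalse he' => exact absurd he' he
  | loopFalse he =>
    cases h₂ with
    | loopFalse => exact ⟨rfl, rfl⟩
    | loopTrue he' _ _ => exact absurd he he'

/-- The program `p` halts from memory `s`, and its final memory and running time satisfy `Q`. -/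
def Halts (w : ℕ) (inp : List ℕ) (p : Stmt) (s : Store) (Q : Store → ℕ → Prop) : Prop :=
  ∃ s' t, Exec w inp p s s' t ∧ Q s' t

theorem Halts.mono {p : Stmt} {s : Store} {Q Q' : Store → ℕ → Prop} (h : Halts w inp p s Q)
    (hQ : ∀ s' t, Q s' t → Q' s' t) : Halts w inp p s Q' :=
  let ⟨s', t, he, hq⟩ := h
  ⟨s', t, he, hQ s' t hq⟩

theorem Halts.skip {s : Store} {Q : Store → ℕ → Prop} (h : Q s 1) :
    Halts w inp .skip s Q := ⟨_, _, .skip s, h⟩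

theorem Halts.assign {x : ℕ} {e : Expr} {s : Store} {Q : Store → ℕ → Prop}
    (h : Q (s.setVar x (e.eval w inp s)) (e.cost + 1)) : Halts w inp (.assign x e) s Q :=
  ⟨_, _, .assign x e s, h⟩

theorem Halts.write {a : ℕ} {i e : Expr} {s : Store} {Q : Store → ℕ → Prop}
    (h : Q (s.setArr a (i.eval w inp s) (e.eval w inp s)) (i.cost + e.cost + 1)) :
    Halts w inp (.write a i e) s Q :=
  ⟨_, _, .write a i e s, h⟩

theorem Halts.seq {p q : Stmt} {s : Store} {Q : Store → ℕ → Prop}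
    (h : Halts w inp p s fun s' t => Halts w inp q s' fun s'' t' => Q s'' (t + t')) :
    Halts w inp (.seq p q) s Q :=
  let ⟨_, _, hp, _, _, hq, hQ⟩ := h
  ⟨_, _, .seq hp hq, hQ⟩

theorem Halts.cond {e : Expr} {p q : Stmt} {s : Store} {Q : Store → ℕ → Prop}
    (hp : e.eval w inp s ≠ 0 → Halts w inp p s fun s' t => Q s' (e.cost + 1 + t))
    (hq : e.eval w inp s = 0 → Halts w inp q s fun s' t => Q s' (e.cost + 1 + t)) :
    Halts w inp (.cond e p q) s Q := by
  by_cases he : e.eval w inp s = 0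
  · obtain ⟨_, _, h, hQ⟩ := hq he
    exact ⟨_, _, .condFalse he h, hQ⟩
  · obtain ⟨_, _, h, hQ⟩ := hp he
    exact ⟨_, _, .condTrue he h, hQ⟩

/-- A loop halts if every iteration keeps the invariant `I` and is paid for by a decrease of the
potential `Φ`; this bounds the total time as well. -/
theorem Halts.loop {e : Expr} {p : Stmt} (I : Store → Prop) (Φ : Store → ℕ)
    (h : ∀ s, I s → e.eval w inp s ≠ 0 →
      Halts w inp p s fun s' t => I s' ∧ t + (e.cost + 1) + Φ s' ≤ Φ s) (s : Store) (hs : I s) :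
    Halts w inp (.loop e p) s fun s' t =>
      I s' ∧ e.eval w inp s' = 0 ∧ t + Φ s' ≤ Φ s + (e.cost + 1) := by
  induction hm : Φ s using Nat.strong_induction_on generalizing s with
  | _ m ih =>
    subst hm
    by_cases he : e.eval w inp s = 0
    · exact ⟨_, _, .loopFalse he, hs, he, by omega⟩
    · -- the test alone takes time, so that every iteration decreases `Φ`
      obtain ⟨s₁, t₁, hp, hI, ht⟩ := h s hs he
      obtain ⟨s₂, t₂, hl, hI₂, he₂, ht₂⟩ := ih _ (by omega) s₁ hI rfl
      exact ⟨_, _, .loopTrue he hp hl, hI₂, he₂, by omega⟩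

/-! ### Memory -/

@[simp] theorem Store.setVar_var (s : Store) (x v y : ℕ) :
    (s.setVar x v).var y = if y = x then v else s.var y := by
  simp [Store.setVar, Function.update_apply]

@[simp] theorem Store.setVar_arr (s : Store) (x v : ℕ) : (s.setVar x v).arr = s.arr := rfl

@[simp] theorem Store.setArr_var (s : Store) (a i v : ℕ) : (s.setArr a i v).var = s.var := rfl

@[simp] theorem Store.setArr_arr (s : Store) (a i v b : ℕ) :
    (s.setArr a i v).arr b = if b = a then Function.update (s.arr a) i v else s.arr b := by
  simp [Store.setArr, Function.update_apply]

/-- Array `0` holds the values, array `1` the stack, and variable `3` its height. -/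
def Store.work (s : Store) : Work := ⟨s.arr 0, s.arr 1, s.var 3⟩

theorem Store.work_setVar (s : Store) {x : ℕ} (v : ℕ) (hx : x ≠ 3) :
    (s.setVar x v).work = s.work := by
  simp [Store.work, hx.symm]

/-- The word size suffices for all addresses and for all positions in the input. -/
structure Fits (n w : ℕ) : Prop where
  pos : 0 < n
  size_lt : size n < 2 ^ w
  input_lt : 2 * (n * n) + 4 < 2 ^ w

theorem Fits.sq_lt {n : ℕ} (h : Fits n w) : n * n < 2 ^ w := by
  have := h.input_lt
  omega

theorem Fits.lt {n : ℕ} (h : Fits n w) : n + 1 < 2 ^ w := by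
  have := h.input_lt
  have := Nat.le_mul_self n
  omega

theorem Fits.lit {n c : ℕ} (h : Fits n w) (hc : c ≤ 4) : c % 2 ^ w = c :=
  Nat.mod_eq_of_lt (by have := h.input_lt; omega)

/-! ### The program -/

/-- The address of the entry `(i, j)` of the `k`-th matrix; variable `1` holds the size `n`. -/
def addrE (k i j : Expr) : Expr := .add (.mul (.add (.mul k (.var 1)) i) (.var 1)) j

/-- A nonzero value says that the entry `(i, j)` is supported by the matrix number `k`, where `k`
is in variable `4`, and `i` and `j` are in the variables `x` and `y`. -/
def supportE (x y : ℕ) : Expr :=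
  .add (.read 0 (addrE (.var 4) (.var x) (.var y)))
    (.mul (.read 0 (addrE (.var 4) (.var x) (.var 4))) (.read 0 (addrE (.var 4) (.var 4) (.var y))))

/-- Clear the entry at the address in variable `7`, and put this address on the stack. -/
def clearCode : Stmt :=
  .seq (.write 0 (.var 7) (.lit 0))
    (.seq (.write 1 (.var 3) (.var 7)) (.assign 3 (.add (.var 3) (.lit 1))))

/-- Clear an entry of the matrix number `k + 1` if it has lost its support. -/
def recheckCode (x y : ℕ) : Stmt :=
  .seq (.assign 7 (addrE (.add (.var 4) (.lit 1)) (.var x) (.var y)))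
    (.cond (.read 0 (.var 7)) (.cond (supportE x y) .skip clearCode) .skip)

/-- Recheck row `i` and column `j` of the matrix number `k + 1`. -/
def crossCode : Stmt :=
  .seq (.assign 8 (.lit 0))
    (.loop (.lt (.var 8) (.var 1))
      (.seq (recheckCode 5 8) (.seq (recheckCode 8 6) (.assign 8 (.add (.var 8) (.lit 1))))))

/-- Take an address off the stack, and recheck all entries that depend on it. -/
def popCode : Stmt :=
  .seq (.assign 3 (.sub (.var 3) (.lit 1)))
  (.seq (.assign 7 (.read 1 (.var 3)))
  (.seq (.assign 4 (.div (.var 7) (.mul (.var 1) (.var 1))))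
  (.seq (.assign 5 (.mod (.div (.var 7) (.var 1)) (.var 1)))
  (.seq (.assign 6 (.mod (.var 7) (.var 1)))
  (.cond (.lt (.var 4) (.var 1))
    (.seq (recheckCode 5 6)
      (.cond (.add (.eq (.var 5) (.var 4)) (.eq (.var 6) (.var 4))) crossCode .skip))
    .skip)))))

/-- Process the stack until it is empty. -/
def drainCode : Stmt := .loop (.var 3) popCode

/-! ### Processing the stack -/

theorem eval_addrE {s : Store} {n k i j : ℕ} {ek ei ej : Expr} (hn : s.var 1 = n)
    (hk : ek.eval w inp s = k) (hi : ei.eval w inp s = i) (hj : ej.eval w inp s = j)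
    (h : addr n k i j < 2 ^ w) : (addrE ek ei ej).eval w inp s = addr n k i j := by
  simp only [addrE, Expr.eval, hk, hi, hj, hn, Nat.mod_add_mod, Nat.mod_mul_mod]
  exact Nat.mod_eq_of_lt h

theorem eval_supportE {s : Store} {n k i j x y : ℕ} (hw : Fits n w)
    (hle : ∀ k' ≤ k, ∀ i < n, ∀ j < n, s.arr 0 (addr n k' i j) ≤ 1) (hk : k < n) (hi : i < n)
    (hj : j < n) (v1 : s.var 1 = n) (v4 : s.var 4 = k) (vx : s.var x = i) (vy : s.var y = j) :
    (supportE x y).eval w inp s ≠ 0 ↔ Support n (s.arr 0) k i j := by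
  have hlt : ∀ {i j : ℕ}, i < n → j < n → addr n k i j < 2 ^ w := fun hi hj =>
    (addr_lt_size hk.le hi hj).trans hw.size_lt
  have e1 : (addrE (.var 4) (.var x) (.var y)).eval w inp s = addr n k i j :=
    eval_addrE v1 v4 vx vy (hlt hi hj)
  have e2 : (addrE (.var 4) (.var x) (.var 4)).eval w inp s = addr n k i k :=
    eval_addrE v1 v4 vx v4 (hlt hi hk)
  have e3 : (addrE (.var 4) (.var 4) (.var y)).eval w inp s = addr n k k j :=
    eval_addrE v1 v4 v4 vy (hlt hk hj)
  have h1 := hle k le_rfl i hi j hj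
  have h2 := hle k le_rfl i hi k hk
  have h3 := hle k le_rfl k hk j hj
  have h4 := hw.input_lt
  simp only [supportE, Expr.eval, e1, e2, e3, Support]
  generalize s.arr 0 (addr n k i j) = a at *
  generalize s.arr 0 (addr n k i k) = b at *
  generalize s.arr 0 (addr n k k j) = c at *
  have hbc : b * c ≤ 1 := by nlinarith
  rw [Nat.mod_eq_of_lt (a := b * c) (by omega), Nat.mod_eq_of_lt (by omega)]
  simp only [ne_eq, Nat.add_eq_zero_iff, Nat.mul_eq_zero]
  tauto

theorem clearCode_spec {s : Store} {n a : ℕ} (hw : Fits n w) (htop : s.var 3 + 1 ≤ size n)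
    (v7 : s.var 7 = a) :
    Halts w inp clearCode s fun s' t =>
      s'.work = s.work.clear a ∧ (∀ z, z ≠ 3 → s'.var z = s.var z) ∧ t = 10 := by
  have hs := hw.size_lt
  refine .seq (.write (.seq (.write (.assign ⟨?_, ?_, rfl⟩))))
  · simp only [Store.work, Work.clear, Expr.eval, v7, Nat.zero_mod, Store.setVar_arr,
      Store.setArr_arr, Store.setVar_var, Store.setArr_var, hw.lit (c := 1) (by norm_num)]
    simp [Nat.mod_eq_of_lt (show s.var 3 + 1 < 2 ^ w by omega)]
  · intro z hz
    simp [hz]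

theorem recheckCode_spec {s : Store} {n k i j x y : ℕ} {X : BMat n} {E : ℕ → ℕ → ℕ → Prop}
    (hw : Fits n w) (h : Inv X E s.work) (hk : k < n) (hi : i < n) (hj : j < n)
    (v1 : s.var 1 = n) (v4 : s.var 4 = k) (vx : s.var x = i) (vy : s.var y = j)
    (hx : x ≠ 7) (hy : y ≠ 7) :
    Halts w inp (recheckCode x y) s fun s' t =>
      s'.work = s.work.recheck n k i j ∧ (∀ z, z ≠ 3 → z ≠ 7 → s'.var z = s.var z) ∧
        t ≤ 60 := by
  have ha : addr n (k + 1) i j < size n := addr_lt_size hk hi hj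
  have e7 : (addrE (.add (.var 4) (.lit 1)) (.var x) (.var y)).eval w inp s
      = addr n (k + 1) i j := by
    refine eval_addrE v1 ?_ vx vy (ha.trans hw.size_lt)
    have := hw.lt
    simp only [Expr.eval, v4, hw.lit (c := 1) (by norm_num)]
    exact Nat.mod_eq_of_lt (by omega)
  have hsup : (supportE x y).eval w inp (s.setVar 7 (addr n (k + 1) i j)) ≠ 0 ↔
      Support n (s.arr 0) k i j :=
    eval_supportE (s := s.setVar 7 _) hw (fun k' hk' i hi j hj =>
      h.le_one _ (addr_lt_size (by omega) hi hj)) hk hi hj (by simpa) (by simpa)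
      (by simpa [hx]) (by simpa [hy])
  refine .seq (.assign (.cond ?_ ?_))
  · rw [e7]
    intro h0
    have h0 : s.work.val (addr n (k + 1) i j) ≠ 0 := by
      simpa [Expr.eval, Store.work] using h0
    refine .cond ?_ ?_
    · intro hs
      refine .skip ⟨?_, ?_, by simp [Expr.cost, addrE, supportE]⟩
      · rw [Store.work_setVar _ _ (by norm_num), Work.recheck, if_neg]
        exact fun hc => hc.2 (hsup.1 hs)
      · intro z _ hz
        simp [hz]
    · intro hs
      have h1 : s.work.val (addr n (k + 1) i j) = 1 := by
        have := h.le_one _ ha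
        omega
      have htop : s.var 3 + 1 ≤ size n := h.top_lt ha h1
      refine (clearCode_spec (a := addr n (k + 1) i j) hw (by simpa) (by simp)).mono ?_
      rintro s' t ⟨hw', hv', rfl⟩
      refine ⟨?_, ?_, by simp [Expr.cost, addrE, supportE]⟩
      · rw [hw', Store.work_setVar _ _ (by norm_num), Work.recheck, if_pos]
        exact ⟨h0, fun hc => hsup.2 hc hs⟩
      · intro z hz3 hz7
        rw [hv' z hz3]
        simp [hz7]
  · rw [e7]
    intro h0
    have h0 : s.work.val (addr n (k + 1) i j) = 0 := by
      simpa [Expr.eval, Store.work] using h0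
    refine .skip ⟨?_, ?_, by simp [Expr.cost, addrE]⟩
    · rw [Store.work_setVar _ _ (by norm_num), Work.recheck, if_neg]
      exact fun hc => hc.1 h0
    · intro z _ hz
      simp [hz]

theorem crossCode_spec {s : Store} {n k i j : ℕ} {X : BMat n} {E : ℕ → ℕ → ℕ → Prop}
    (hw : Fits n w) (hE : ∀ k' < n, ∀ i' < n, ∀ j' < n, E k' i' j' → k' = k ∧ (i' = i ∨ j' = j))
    (h : Inv X E s.work) (hk : k < n) (hi : i < n) (hj : j < n)
    (v1 : s.var 1 = n) (v4 : s.var 4 = k) (v5 : s.var 5 = i) (v6 : s.var 6 = j) :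
    Halts w inp crossCode s fun s' t =>
      s'.var 1 = n ∧ Inv X (fun _ _ _ => False) s'.work ∧
        s'.work.potential n ≤ s.work.potential n ∧ t ≤ 6 + 128 * n := by
  refine .seq (.assign ?_)
  simp only [Expr.eval, Nat.zero_mod]
  -- the positions from variable `8` on, in row `i` and in column `j`, are still to be rechecked
  refine (Halts.loop (fun s' => s'.var 1 = n ∧ s'.var 4 = k ∧ s'.var 5 = i ∧ s'.var 6 = j ∧
      Inv X (fun k' i' j' => k' = k ∧ (i' = i ∧ s'.var 8 ≤ j' ∨ j' = j ∧ s'.var 8 ≤ i')) s'.work ∧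
      s'.work.potential n ≤ s.work.potential n)
    (fun s' => 128 * (n - s'.var 8)) ?_ _ ?_).mono ?_
  · rintro s' ⟨v1, v4, v5, v6, hI, hp⟩ h8
    have h8 : s'.var 8 < n := by simpa [Expr.eval, v1] using h8
    refine .seq ((recheckCode_spec hw hI hk hi h8 v1 v4 v5 rfl (by norm_num) (by norm_num)).mono ?_)
    rintro s₁ t₁ ⟨hw₁, hv₁, ht₁⟩
    have hI₁ := hI.recheck hk hi h8
    have hp₁ := hI.pot_recheck_le hk hi h8 (popCost_le_entryCost n)
    rw [← hw₁] at hI₁ hp₁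
    have v8 : s₁.var 8 = s'.var 8 := hv₁ 8 (by norm_num) (by norm_num)
    have w1 := hv₁ 1 (by norm_num) (by norm_num)
    have w4 := hv₁ 4 (by norm_num) (by norm_num)
    have w5 := hv₁ 5 (by norm_num) (by norm_num)
    have w6 := hv₁ 6 (by norm_num) (by norm_num)
    refine .seq ((recheckCode_spec hw hI₁ hk h8 hj (w1.trans v1) (w4.trans v4) v8 (w6.trans v6)
      (by norm_num) (by norm_num)).mono ?_)
    rintro s₂ t₂ ⟨hw₂, hv₂, ht₂⟩
    have hI₂ := hI₁.recheck hk h8 hj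
    have hp₂ := hI₁.pot_recheck_le hk h8 hj (popCost_le_entryCost n)
    rw [← hw₂] at hI₂ hp₂
    have v8' : s₂.var 8 = s'.var 8 := (hv₂ 8 (by norm_num) (by norm_num)).trans v8
    have x1 := hv₂ 1 (by norm_num) (by norm_num)
    have x4 := hv₂ 4 (by norm_num) (by norm_num)
    have x5 := hv₂ 5 (by norm_num) (by norm_num)
    have x6 := hv₂ 6 (by norm_num) (by norm_num)
    have hlt := hw.lt
    have e8 : Expr.eval w inp s₂ (.add (.var 8) (.lit 1)) = s'.var 8 + 1 := by
      simp only [Expr.eval, v8', hw.lit (c := 1) (by norm_num)]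
      exact Nat.mod_eq_of_lt (by omega)
    refine .assign ?_
    rw [e8]
    refine ⟨⟨by simp [x1, w1, v1], by simp [x4, w4, v4], by simp [x5, w5, v5],
      by simp [x6, w6, v6], ?_, ?_⟩, ?_⟩
    · rw [Store.work_setVar _ _ (by norm_num)]
      refine hI₂.mono ?_
      rintro k' - i' - j' - ⟨⟨⟨hk', he⟩, hn₁⟩, hn₂⟩
      simp only [Store.setVar_var, if_true, hk', true_and] at he hn₁ hn₂ ⊢
      omega
    · rw [Store.work_setVar _ _ (by norm_num)]
      exact (hp₂.trans hp₁).trans hp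
    · simp only [Store.setVar_var, if_true, Expr.cost]
      omega
  · refine ⟨by simpa, by simpa, by simpa, by simpa, ?_, ?_⟩
    · rw [Store.work_setVar _ _ (by norm_num)]
      refine h.mono fun k' hk' i' hi' j' hj' he => ?_
      obtain ⟨h1, h2⟩ := hE k' hk' i' hi' j' hj' he
      simp only [Store.setVar_var, if_true]
      omega
    · rw [Store.work_setVar _ _ (by norm_num)]
  · rintro s' t ⟨⟨v1, -, -, -, hI, hp⟩, he, ht⟩
    have h8 : n ≤ s'.var 8 := by simpa [Expr.eval, v1] using he
    refine ⟨v1, hI.mono ?_, hp, ?_⟩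
    · intro k' hk' i' hi' j' hj' h'
      omega
    · simp only [Store.setVar_var, if_true, Expr.cost] at ht ⊢
      omega

theorem popCode_spec {s : Store} {n : ℕ} {X : BMat n} (hw : Fits n w)
    (h : Inv X (fun _ _ _ => False) s.work) (v1 : s.var 1 = n) (h3 : s.var 3 ≠ 0) :
    Halts w inp popCode s fun s' t =>
      s'.var 1 = n ∧ Inv X (fun _ _ _ => False) s'.work ∧
        t + 2 + s'.work.potential n ≤ s.work.potential n := by
  have hn := hw.pos
  have hpot := Work.pot_pop n (entryCost n) (popCost n) (m := s.work) h3
  set b := s.work.stack (s.work.top - 1) with hb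
  have hbs : b < size n := h.stack_lt _ (Nat.sub_lt (Nat.pos_of_ne_zero h3) one_pos)
  have hk : b / (n * n) ≤ n := div_le_of_lt_size hbs
  have hi : b / n % n < n := Nat.mod_lt _ hn
  have hj : b % n < n := Nat.mod_lt _ hn
  have hInv := h.pop h3 hi hj (k := b / (n * n)) (by rw [addr_decode])
  have hsub : s.arr 1 (s.var 3 - 1) = b := rfl
  refine .seq (.assign (.seq (.assign (.seq (.assign (.seq (.assign (.seq (.assign ?_)))))))))
  simp only [Expr.eval, Store.setVar_var, Store.setVar_arr, if_true, v1, hw.lit (c := 1)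
    (by norm_num), Nat.mod_eq_of_lt hw.sq_lt, if_false, Nat.reduceEqDiff, hsub, Expr.cost]
  set s₁ := ((((s.setVar 3 (s.var 3 - 1)).setVar 7 b).setVar 4 (b / (n * n))).setVar 5
    (b / n % n)).setVar 6 (b % n) with hs₁
  have u1 : s₁.var 1 = n := by simp [hs₁, v1]
  have u4 : s₁.var 4 = b / (n * n) := by simp [hs₁]
  have u5 : s₁.var 5 = b / n % n := by simp [hs₁]
  have u6 : s₁.var 6 = b % n := by simp [hs₁]
  have uw : s₁.work = s.work.pop := by simp [hs₁, Store.work, Work.pop]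
  rw [← uw] at hInv hpot
  have hpc : popCost n b = 300 + if b / n % n = b / (n * n) ∨ b % n = b / (n * n)
    then 300 * n else 0 := rfl
  refine .cond ?_ ?_
  · intro hlt
    have hk : b / (n * n) < n := by simpa [Expr.eval, u1, u4] using hlt
    refine .seq ((recheckCode_spec hw hInv hk hi hj u1 u4 u5 u6 (by norm_num)
      (by norm_num)).mono ?_)
    rintro s₂ t₂ ⟨hw₂, hv₂, ht₂⟩
    have hI₂ := hInv.recheck hk hi hj
    have hp₂ := hInv.pot_recheck_le hk hi hj (popCost_le_entryCost n)
    rw [← hw₂] at hI₂ hp₂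
    have x1 := (hv₂ 1 (by norm_num) (by norm_num)).trans u1
    have x4 := (hv₂ 4 (by norm_num) (by norm_num)).trans u4
    have x5 := (hv₂ 5 (by norm_num) (by norm_num)).trans u5
    have x6 := (hv₂ 6 (by norm_num) (by norm_num)).trans u6
    have hcond : Expr.eval w inp s₂ (.add (.eq (.var 5) (.var 4)) (.eq (.var 6) (.var 4))) ≠ 0 ↔
        (b / n % n = b / (n * n) ∨ b % n = b / (n * n)) := by
      have := hw.input_lt
      simp only [Expr.eval, x4, x5, x6]
      split_ifs with h1 h2 h2 <;> simp [h1, h2, hw.lit]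
    refine .cond ?_ ?_
    · intro hc
      have hc := hcond.1 hc
      rw [if_pos hc] at hpc
      refine (crossCode_spec hw (fun k' _ i' _ j' _ he => ?_) hI₂ hk hi hj x1 x4 x5 x6).mono ?_
      · exact ⟨he.1.1, he.1.2.elim (fun e => Or.inl e.1) And.left⟩
      · rintro s₃ t₃ ⟨y1, hI₃, hp₃, ht₃⟩
        refine ⟨y1, hI₃, ?_⟩
        simp only [Work.potential, Expr.cost] at *
        omega
    · intro hc
      have hc : ¬ (b / n % n = b / (n * n) ∨ b % n = b / (n * n)) := fun hc' => hcond.2 hc' hc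
      rw [if_neg hc] at hpc
      refine .skip ⟨x1, hI₂.mono ?_, ?_⟩
      · rintro k' - i' - j' - ⟨⟨rfl, h1⟩, h2⟩
        rcases h1 with h1 | h1
        · exact h2 ⟨rfl, h1⟩
        · exact hc h1.2
      · simp only [Work.potential, Expr.cost] at *
        omega
  · -- nothing depends on the entries of the last matrix
    intro hge
    have hk : n ≤ b / (n * n) := by simpa [Expr.eval, u1, u4] using hge
    refine .skip ⟨u1, hInv.mono ?_, ?_⟩
    · rintro k' hk' - - - - ⟨rfl, -⟩
      omega
    · simp only [Work.potential, Expr.cost] at *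
      omega

theorem drainCode_spec {s : Store} {n : ℕ} {X : BMat n} (hw : Fits n w)
    (h : Inv X (fun _ _ _ => False) s.work) (v1 : s.var 1 = n) :
    Halts w inp drainCode s fun s' t =>
      Inv X (fun _ _ _ => False) s'.work ∧ s'.var 3 = 0 ∧
        t + s'.work.potential n ≤ s.work.potential n + 2 := by
  refine (Halts.loop (fun s' => s'.var 1 = n ∧ Inv X (fun _ _ _ => False) s'.work)
    (fun s' => s'.work.potential n) ?_ s ⟨v1, h⟩).mono ?_
  · rintro s' ⟨v1, hI⟩ h3
    refine (popCode_spec hw hI v1 h3).mono ?_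
    rintro s'' t ⟨y1, hI', ht⟩
    refine ⟨⟨y1, hI'⟩, ?_⟩
    simp only [Expr.cost]
    omega
  · rintro s' t ⟨⟨-, hI⟩, h3, ht⟩
    exact ⟨hI, h3, ht⟩

/-! ### Building all matrices from scratch -/

/-- Replace every entry of the matrix number `0` by the value of `e`, which may refer to the address
of the entry in variable `2`. -/
def fillCode (e : Expr) : Stmt :=
  .seq (.assign 2 (.lit 0))
    (.loop (.lt (.var 2) (.mul (.var 1) (.var 1)))
      (.seq (.write 0 (.var 2) e) (.assign 2 (.add (.var 2) (.lit 1)))))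

/-- Compute all further matrices from the matrix number `0`. -/
def rebuildCode : Stmt :=
  .seq (.assign 2 (.mul (.var 1) (.var 1)))
    (.loop (.lt (.var 2) (.mul (.mul (.add (.var 1) (.lit 1)) (.var 1)) (.var 1)))
      (.seq (.assign 4 (.sub (.div (.var 2) (.mul (.var 1) (.var 1))) (.lit 1)))
      (.seq (.assign 5 (.mod (.div (.var 2) (.var 1)) (.var 1)))
      (.seq (.assign 6 (.mod (.var 2) (.var 1)))
      (.seq (.write 0 (.var 2) (.lt (.lit 0) (supportE 5 6)))
        (.assign 2 (.add (.var 2) (.lit 1))))))))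

/-- Replace the matrix number `0` according to `e`, and rebuild the others. -/
def loadCode (e : Expr) : Stmt :=
  .seq (.assign 1 (.input (.lit 0))) (.seq (fillCode e) rebuildCode)

theorem Expr.eval_lit (s : Store) (c : ℕ) : (Expr.lit c).eval w inp s = c % 2 ^ w := rfl

theorem Expr.eval_var (s : Store) (x : ℕ) : (Expr.var x).eval w inp s = s.var x := rfl

theorem Expr.eval_sub (s : Store) (e f : Expr) :
    (Expr.sub e f).eval w inp s = e.eval w inp s - f.eval w inp s := rfl

theorem Expr.eval_mul (s : Store) (e f : Expr) :
    (Expr.mul e f).eval w inp s = (e.eval w inp s * f.eval w inp s) % 2 ^ w := rfl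

theorem Expr.eval_div (s : Store) (e f : Expr) :
    (Expr.div e f).eval w inp s = e.eval w inp s / f.eval w inp s := rfl

theorem Expr.eval_mod (s : Store) (e f : Expr) :
    (Expr.mod e f).eval w inp s = e.eval w inp s % f.eval w inp s := rfl

theorem Expr.eval_lt_eq_zero (s : Store) (e f : Expr) :
    (Expr.lt e f).eval w inp s = 0 ↔ f.eval w inp s ≤ e.eval w inp s := by
  simp [Expr.eval]

theorem Expr.eval_eq_eq_zero (s : Store) (e f : Expr) :
    (Expr.eq e f).eval w inp s = 0 ↔ e.eval w inp s ≠ f.eval w inp s := by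
  simp [Expr.eval]

theorem eval_succ {s : Store} {x a : ℕ} (hx : s.var x = a) (hlt : a + 1 < 2 ^ w) :
    Expr.eval w inp s (.add (.var x) (.lit 1)) = a + 1 := by
  simp only [Expr.eval, hx]
  rw [Nat.mod_eq_of_lt (a := 1) (by omega), Nat.mod_eq_of_lt hlt]

theorem eval_size {s : Store} {n : ℕ} (hw : Fits n w) (v1 : s.var 1 = n) :
    Expr.eval w inp s (.mul (.mul (.add (.var 1) (.lit 1)) (.var 1)) (.var 1)) = size n := by
  simp only [Expr.eval, v1, hw.lit (c := 1) (by norm_num), Nat.mod_mul_mod]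
  exact Nat.mod_eq_of_lt hw.size_lt

theorem size_eq (n : ℕ) : size n = n * (n * n) + n * n := by
  unfold size; ring

theorem fillCode_spec {s : Store} {n : ℕ} {X X' : BMat n} {e : Expr} (hw : Fits n w)
    (v1 : s.var 1 = n) (hX : ∀ i j : Fin n, s.arr 0 (addr n 0 i j) = (X i j).toNat)
    (he : ∀ (i j : Fin n) (s' : Store), s'.var 1 = n → s'.var 2 = addr n 0 i j →
      s'.arr 0 (addr n 0 i j) = (X i j).toNat → e.eval w inp s' = (X' i j).toNat) :
    Halts w inp (fillCode e) s fun s' t =>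
      s'.var 1 = n ∧ s'.var 3 = s.var 3 ∧
        (∀ i j : Fin n, s'.arr 0 (addr n 0 i j) = (X' i j).toNat) ∧
        t ≤ (e.cost + 20) * (n * n) + 20 := by
  have hsq := hw.sq_lt
  refine .seq (.assign ?_)
  simp only [Expr.eval, Nat.zero_mod]
  refine (Halts.loop (fun s' => s'.var 1 = n ∧ s'.var 3 = s.var 3 ∧ ∀ i j : Fin n,
      s'.arr 0 (addr n 0 i j) = if addr n 0 i j < s'.var 2 then (X' i j).toNat else (X i j).toNat)
    (fun s' => (e.cost + 20) * (n * n - s'.var 2)) ?_ _ ?_).mono ?_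
  · rintro s' ⟨v1, v3, hA⟩ h2
    have h2 : s'.var 2 < n * n := by
      simpa [Expr.eval, v1, Nat.mod_eq_of_lt hsq] using h2
    obtain ⟨i, j, hij⟩ : ∃ i j : Fin n, s'.var 2 = addr n 0 i j := by
      refine ⟨⟨s'.var 2 / n % n, Nat.mod_lt _ hw.pos⟩, ⟨s'.var 2 % n, Nat.mod_lt _ hw.pos⟩, ?_⟩
      have := addr_decode n (s'.var 2)
      rw [Nat.div_eq_of_lt h2] at this
      exact this.symm
    have hv : e.eval w inp s' = (X' i j).toNat :=
      he i j s' v1 hij (by rw [hA, if_neg (by omega)])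
    refine .seq (.write (.assign ?_))
    rw [eval_succ (w := w) (s := s'.setArr 0 _ _) (x := 2) (a := s'.var 2) rfl (by omega), hv]
    refine ⟨⟨by simpa, by simpa, fun i' j' => ?_⟩, ?_⟩
    · simp only [Store.setVar_arr, Store.setArr_arr, if_true, Store.setVar_var, Expr.eval]
      by_cases hc : addr n 0 i' j' = s'.var 2
      · obtain ⟨-, h1, h3⟩ := addr_inj i'.2 j'.2 i.2 j.2 (hc.trans hij)
        obtain rfl := Fin.ext h1
        obtain rfl := Fin.ext h3
        rw [hc, Function.update_self, if_pos (by omega)]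
      · rw [Function.update_of_ne hc, hA]
        exact if_congr (by omega) rfl rfl
    · simp only [Store.setVar_var, if_true, Expr.cost]
      obtain ⟨d, hd⟩ : ∃ d, n * n - s'.var 2 = d + 1 := ⟨n * n - s'.var 2 - 1, by omega⟩
      rw [hd, show n * n - (s'.var 2 + 1) = d by omega, Nat.mul_succ]
      omega
  · exact ⟨by simpa, by simp, by simpa using hX⟩
  · rintro s' t ⟨⟨v1, v3, hA⟩, h2, ht⟩
    have h2 : n * n ≤ s'.var 2 := by
      simpa [Expr.eval, v1, Nat.mod_eq_of_lt hsq] using h2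
    refine ⟨v1, v3, fun i j => ?_, ?_⟩
    · have := addr_lt_mul (k := 0) i.2 j.2
      rw [hA, if_pos (by omega)]
    · simp only [Store.setVar_var, if_true, Expr.cost, Nat.sub_zero] at ht ⊢
      omega

theorem support_congr {n k i j : ℕ} {g g' : ℕ → ℕ} (hk : k < n) (hi : i < n) (hj : j < n)
    (h : ∀ i < n, ∀ j < n, g (addr n k i j) = g' (addr n k i j)) :
    Support n g k i j ↔ Support n g' k i j := by
  simp only [Support, h i hi j hj, h i hi k hk, h k hk j hj]

theorem rebuildCode_spec {s : Store} {n : ℕ} {X : BMat n} (hw : Fits n w)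
    (v1 : s.var 1 = n) (v3 : s.var 3 = 0)
    (hX : ∀ i j : Fin n, s.arr 0 (addr n 0 i j) = (X i j).toNat) :
    Halts w inp rebuildCode s fun s' t =>
      s'.var 3 = 0 ∧ Inv X (fun _ _ _ => False) s'.work ∧ t ≤ 100 * size n + 20 := by
  have hsq := hw.sq_lt
  have hsz := hw.size_lt
  have hsq_le : n * n ≤ size n := by rw [size_eq]; omega
  refine .seq (.assign ?_)
  simp only [Expr.eval, v1, Nat.mod_eq_of_lt hsq]
  refine (Halts.loop (fun s' => s'.var 1 = n ∧ s'.var 3 = 0 ∧ n * n ≤ s'.var 2 ∧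
      (∀ i j : Fin n, s'.arr 0 (addr n 0 i j) = (X i j).toNat) ∧
      ∀ k < n, ∀ i < n, ∀ j < n, addr n (k + 1) i j < s'.var 2 →
        s'.arr 0 (addr n (k + 1) i j) ≤ 1 ∧
        (s'.arr 0 (addr n (k + 1) i j) ≠ 0 ↔ Support n (s'.arr 0) k i j))
    (fun s' => 100 * (size n - s'.var 2)) ?_ _ ?_).mono ?_
  · rintro s' ⟨v1, v3, hge, hA, hS⟩ h2
    have h2 : s'.var 2 < size n := by
      rw [ne_eq, Expr.eval_lt_eq_zero, eval_size hw v1, not_le] at h2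
      exact h2
    set a := s'.var 2 with ha
    have hn := hw.pos
    have hi : a / n % n < n := Nat.mod_lt _ hn
    have hj : a % n < n := Nat.mod_lt _ hn
    obtain ⟨k, hk⟩ : ∃ k, a / (n * n) = k + 1 := by
      have : 1 ≤ a / (n * n) := (Nat.one_le_div_iff (Nat.mul_pos hn hn)).2 hge
      exact ⟨a / (n * n) - 1, by omega⟩
    have hkn : k < n := by have := div_le_of_lt_size h2; omega
    have hdec : a = addr n (k + 1) (a / n % n) (a % n) := by rw [← hk, addr_decode]
    refine .seq (.assign (.seq (.assign (.seq (.assign (.seq (.write (.assign ?_))))))))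
    simp only [Expr.eval_lit, Expr.eval_var, Expr.eval_sub, Expr.eval_mul, Expr.eval_div,
      Expr.eval_mod, Store.setVar_var, if_true, v1, hw.lit (c := 1)
      (by norm_num), Nat.mod_eq_of_lt hsq, if_false, Nat.reduceEqDiff, hk, Nat.add_sub_cancel,
      OfNat.one_ne_ofNat, ← ha]
    set s₁ := ((s'.setVar 4 k).setVar 5 (a / n % n)).setVar 6 (a % n) with hs₁
    have hle : ∀ k' ≤ k, ∀ i < n, ∀ j < n, s'.arr 0 (addr n k' i j) ≤ 1 := by
      intro k' hk' i hi j hj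
      cases k' with
      | zero => rw [hA ⟨i, hi⟩ ⟨j, hj⟩]; exact Bool.toNat_le _
      | succ k' =>
        refine (hS k' (by omega) i hi j hj ?_).1
        calc addr n (k' + 1) i j < (k' + 1 + 1) * (n * n) := addr_lt_mul hi hj
          _ ≤ (k + 1) * (n * n) := Nat.mul_le_mul_right _ (by omega)
          _ ≤ a := by rw [hdec]; exact mul_le_addr _ _ _ _
    have hsup : (supportE 5 6).eval w inp s₁ ≠ 0 ↔
        Support n (s'.arr 0) k (a / n % n) (a % n) :=
      eval_supportE (s := s₁) hw hle hkn hi hj (by simp [hs₁, v1]) (by simp [hs₁])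
        (by simp [hs₁]) (by simp [hs₁])
    set v := Expr.eval w inp s₁ (.lt (.lit 0) (supportE 5 6)) with hv
    have hv1 : v ≤ 1 := by
      rw [hv, Expr.eval]; split_ifs <;> omega
    have hv0 : v ≠ 0 ↔ Support n (s'.arr 0) k (a / n % n) (a % n) := by
      rw [← hsup, hv, Expr.eval]
      simp [Expr.eval, Nat.pos_iff_ne_zero]
    have harr : s₁.arr 0 = s'.arr 0 := rfl
    -- the write does not touch the matrices that the new entry, or an earlier one, is computed from
    have hlow : ∀ k' ≤ k, ∀ i < n, ∀ j < n, addr n k' i j ≠ a := by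
      intro k' hk' i₁ hi₁ j₁ hj₁ e
      rw [hdec] at e
      have := (addr_inj hi₁ hj₁ hi hj e).1
      omega
    have hnv : s₁.var 2 = a := by simp [hs₁, ha]
    rw [eval_succ (w := w) (s := s₁.setArr 0 a v) (x := 2) hnv (by omega)]
    refine ⟨⟨by simp [hs₁, v1], by simp [hs₁, v3], ?_, ?_, ?_⟩, ?_⟩
    · omega
    · intro i j
      simp only [Store.setVar_arr, Store.setArr_arr, if_true, harr]
      rw [Function.update_of_ne (hlow 0 (Nat.zero_le _) i i.2 j j.2), hA]
    · intro k' hk' i' hi' j' hj' hlt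
      simp only [Store.setVar_arr, Store.setArr_arr, if_true, harr] at hlt ⊢
      have hk'k : k' ≤ k := by
        by_contra hcon
        have h1 := mul_le_addr n (k' + 1) i' j'
        have h2 : a < (k + 1 + 1) * (n * n) := by rw [hdec]; exact addr_lt_mul hi hj
        have h3 : (k + 1 + 1) * (n * n) ≤ (k' + 1) * (n * n) :=
          Nat.mul_le_mul_right _ (by omega)
        omega
      have hsc : Support n (Function.update (s'.arr 0) a v) k' i' j' ↔
          Support n (s'.arr 0) k' i' j' :=
        support_congr hk' hi' hj' fun i₁ hi₁ j₁ hj₁ =>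
          Function.update_of_ne (hlow k' hk'k i₁ hi₁ j₁ hj₁) _ _
      rw [hsc]
      by_cases hc : addr n (k' + 1) i' j' = a
      · have := addr_inj hi' hj' hi hj (hc.trans hdec)
        obtain ⟨h1, h2, h3⟩ := this
        obtain rfl : k' = k := by omega
        rw [hc, Function.update_self, h2, h3]
        exact ⟨hv1, hv0⟩
      · rw [Function.update_of_ne hc]
        exact hS k' hk' i' hi' j' hj' (by omega)
    · simp only [Expr.cost, supportE, addrE]
      omega
  · refine ⟨by simpa, by simpa, by simp, by simpa using hX, ?_⟩
    intro k _ i _ j _ hlt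
    have := mul_le_addr n (k + 1) i j
    simp only [Store.setVar_var, if_true] at hlt
    have : n * n ≤ (k + 1) * (n * n) := Nat.le_mul_of_pos_left _ (by omega)
    omega
  · rintro s' t ⟨⟨v1, v3, -, hA, hS⟩, he, ht⟩
    have h2 : size n ≤ s'.var 2 := by
      rw [Expr.eval_lt_eq_zero, eval_size hw v1] at he
      exact he
    have hS' := fun k hk i hi j hj => hS k hk i hi j hj
      ((addr_lt_size (k := k + 1) hk hi hj).trans_le h2)
    have hone : ∀ b < size n, s'.arr 0 b ≤ 1 := by
      intro b hb
      have hn := hw.pos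
      have hi : b / n % n < n := Nat.mod_lt _ hn
      have hj : b % n < n := Nat.mod_lt _ hn
      have hk := div_le_of_lt_size hb
      have hdec := addr_decode n b
      rw [← hdec]
      cases hkb : b / (n * n) with
      | zero => exact (hA ⟨_, hi⟩ ⟨_, hj⟩).trans_le (Bool.toNat_le _)
      | succ k => exact (hS' k (by omega) _ hi _ hj).1
    refine ⟨v3, ⟨hone, ?_, ?_, hA, ?_, ?_⟩, ?_⟩
    · have h3 : s'.work.top = 0 := v3
      simp only [Work.pot, h3, Finset.range_zero, Finset.sum_empty, Nat.add_zero, mul_one]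
      calc ∑ b ∈ Finset.range (size n), s'.work.val b ≤ ∑ b ∈ Finset.range (size n), 1 :=
            Finset.sum_le_sum fun b hb => hone b (Finset.mem_range.1 hb)
        _ = size n := by simp
    · intro t ht
      have h3 : s'.work.top = 0 := v3
      omega
    · exact fun k hk i hi j hj h => (hS' k hk i hi j hj).2.2 h
    · exact fun k hk i hi j hj h => Or.inl ((hS' k hk i hi j hj).2.1 h)
    · simp only [Store.setVar_var, if_true, Expr.cost] at ht ⊢
      omega

/-- The memory represents the matrix `X`, with no work left to do. -/
structure Rep {n : ℕ} (X : BMat n) (s : Store) : Prop where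
  top : s.var 3 = 0
  inv : Inv X (fun _ _ _ => False) s.work

theorem loadCode_spec {s : Store} {n : ℕ} {X X' : BMat n} {e : Expr} (hw : Fits n w)
    (hinp : inp.getD 0 0 = n) (h : Rep X s)
    (he : ∀ (i j : Fin n) (s' : Store), s'.var 1 = n → s'.var 2 = addr n 0 i j →
      s'.arr 0 (addr n 0 i j) = (X i j).toNat → e.eval w inp s' = (X' i j).toNat) :
    Halts w inp (loadCode e) s fun s' t =>
      Rep X' s' ∧ t + s'.work.potential n ≤ (e.cost + 20) * (n * n) + 1100 * size n + 50 := by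
  refine .seq (.assign (.seq ((fillCode_spec hw ?_ ?_ he).mono ?_)))
  · have := hw.lt
    simp only [Expr.eval, Nat.zero_mod, hinp, Store.setVar_var, if_true]
    exact Nat.mod_eq_of_lt (by omega)
  · exact h.inv.base
  · rintro s₁ t₁ ⟨v1, v3, hX', ht₁⟩
    have v3 : s₁.var 3 = 0 := by simpa [h.top] using v3
    refine (rebuildCode_spec hw v1 v3 hX').mono ?_
    rintro s₂ t₂ ⟨v3, hI, ht₂⟩
    have := hI.potential_le hw.pos v3
    refine ⟨⟨v3, hI⟩, ?_⟩
    simp only [Expr.cost]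
    omega

/-! ### The four operations -/

theorem rowMajor_getD {n : ℕ} (Y : BMat n) (i j : Fin n) :
    (Op.rowMajor Y).getD (addr n 0 i j) 0 = (Y i j).toNat := by
  have hlt : addr n 0 i j < n * n := by simpa using addr_lt_mul (k := 0) i.2 j.2
  have h1 : (⟨addr n 0 i j, hlt⟩ : Fin (n * n)).divNat = i := Fin.ext (by
    simp only [Fin.coe_divNat, addr, Nat.zero_mul, Nat.zero_add]
    rw [Nat.mul_comm, Nat.mul_add_div (by have := i.2; omega), Nat.div_eq_of_lt j.2, Nat.add_zero])
  have h2 : (⟨addr n 0 i j, hlt⟩ : Fin (n * n)).modNat = j := Fin.ext (by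
    simpa [Fin.coe_modNat] using addr_mod j.2)
  rw [List.getD_eq_getElem _ _ (by simpa [Op.rowMajor] using hlt)]
  simp only [Op.rowMajor, List.getElem_ofFn, h1, h2]

/-- The entry of the new matrix, as presented to `Init*`. -/
def initE : Expr := .input (.add (.var 2) (.lit 1))

/-- The entry of the current matrix after `Set*`. -/
def setE : Expr :=
  .lt (.lit 0) (.add (.read 0 (.var 2)) (.mul (.input (.add (.var 2) (.lit 2)))
    (.add (.eq (.div (.var 2) (.var 1)) (.input (.lit 1)))
      (.eq (.mod (.var 2) (.var 1)) (.input (.lit 1))))))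

/-- Clear the listed entries, and process the consequences. -/
def resetCode : Stmt :=
  .seq (.assign 1 (.input (.lit 0)))
  (.seq (.assign 2 (.lit 0))
  (.seq (.loop (.lt (.var 2) (.input (.lit 1)))
    (.seq (.assign 5 (.input (.add (.mul (.lit 2) (.var 2)) (.lit 2))))
    (.seq (.assign 6 (.input (.add (.mul (.lit 2) (.var 2)) (.lit 3))))
    (.seq (.assign 7 (addrE (.lit 0) (.var 5) (.var 6)))
    (.seq clearCode (.assign 2 (.add (.var 2) (.lit 1))))))))
  drainCode))

/-- Read the answer off the diagonal and the last matrix. -/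
def lookupCode : Stmt :=
  .seq (.assign 1 (.input (.lit 0)))
  (.cond (.eq (.input (.lit 1)) (.input (.lit 2))) (.assign 0 (.lit 1))
    (.assign 0 (.read 0 (addrE (.var 1) (.input (.lit 1)) (.input (.lit 2))))))

/-- Decremental Warshall. -/
def warshall : DataStructure := ⟨loadCode initE, loadCode setE, resetCode, lookupCode⟩

theorem initOp_spec {s : Store} {n : ℕ} {X : BMat n} (hw : Fits n w) (h : Rep X s) (Y : BMat n) :
    Halts w (Op.initOp Y).args (loadCode initE) s fun s' t =>
      Rep Y s' ∧ t + s'.work.potential n ≤ 2000 * size n := by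
  refine (loadCode_spec (X' := Y) hw rfl h ?_).mono ?_
  · intro i j s' v1 v2 _
    have hlt := (addr_lt_mul (k := 0) i.2 j.2)
    have := hw.input_lt
    rw [initE, Expr.eval, eval_succ v2 (by omega)]
    simp only [Op.args, List.getD_cons_succ, rowMajor_getD]
    exact Nat.mod_eq_of_lt (by have := Bool.toNat_le (Y i j); omega)
  · rintro s' t ⟨hR, ht⟩
    refine ⟨hR, ht.trans ?_⟩
    have hn : 1 * 1 ≤ n * n := Nat.mul_le_mul hw.pos hw.pos
    have : 1 * (n * n) ≤ n * (n * n) := Nat.mul_le_mul_right _ hw.pos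
    rw [size_eq]
    simp only [initE, Expr.cost]
    omega

theorem setOp_spec {s : Store} {n : ℕ} {X : BMat n} (hw : Fits n w) (h : Rep X s) (i : Fin n)
    (D : BMat n) :
    Halts w (Op.setOp i D).args (loadCode setE) s fun s' _ =>
      Rep (Op.apply X (.setOp i D)) s' := by
  refine (loadCode_spec (X' := Op.apply X (.setOp i D)) hw rfl h ?_).mono fun _ _ h => h.1
  intro x y s' v1 v2 hA
  have hlt := (addr_lt_mul (k := 0) x.2 y.2)
  have hlw := hw.lt
  have hin := hw.input_lt
  have hi : (i : ℕ) % 2 ^ w = i := Nat.mod_eq_of_lt (by have := i.2; omega)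
  have hx : addr n 0 x y / n = x := by
    rw [addr, Nat.zero_mul, Nat.zero_add, Nat.mul_comm, Nat.mul_add_div hw.pos,
      Nat.div_eq_of_lt y.2, Nat.add_zero]
  have hy : addr n 0 x y % n = y := addr_mod y.2
  have h2 : (addr n 0 x y + 2) % 2 ^ w = addr n 0 x y + 2 := Nat.mod_eq_of_lt (by omega)
  have hD : (D x y).toNat % 2 ^ w = (D x y).toNat :=
    Nat.mod_eq_of_lt (by have := Bool.toNat_le (D x y); omega)
  have hc : ∀ c ≤ 4, c % 2 ^ w = c := fun c => hw.lit
  simp only [setE, Expr.eval, v1, v2, hA, hx, hy, hc 1 (by norm_num), hc 2 (by norm_num),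
    Nat.zero_mod, h2, Op.args, List.getD_cons_succ, List.getD_cons_zero, rowMajor_getD, hi, hD,
    Op.apply, Matrix.of_apply, Fin.val_inj]
  cases X x y <;> cases D x y <;> by_cases hxi : x = i <;> by_cases hyi : y = i <;>
    simp [hxi, hyi, hc]

theorem flatMap_getD {n : ℕ} (D : List (Fin n × Fin n)) (t : ℕ) (ht : t < D.length) :
    (D.flatMap fun p => [(p.1 : ℕ), (p.2 : ℕ)]).getD (2 * t) 0 = D[t].1 ∧
      (D.flatMap fun p => [(p.1 : ℕ), (p.2 : ℕ)]).getD (2 * t + 1) 0 = D[t].2 := by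
  induction D generalizing t with
  | nil => simp at ht
  | cons p D ih =>
    cases t with
    | zero => simp
    | succ t =>
      have := ih t (by simpa using ht)
      simpa [Nat.mul_succ] using this

theorem length_le_of_nodup {n : ℕ} {D : List (Fin n × Fin n)} (h : D.Nodup) :
    D.length ≤ n * n := by
  simpa using h.length_le_card

theorem apply_reset_take_succ {n : ℕ} (X : BMat n) (D : List (Fin n × Fin n)) (t : ℕ)
    (ht : t < D.length) :
    Op.apply (Op.apply X (.resetOp (D.take t))) (.resetOp [D[t]])
      = Op.apply X (.resetOp (D.take (t + 1))) := by
  ext x y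
  simp only [Op.apply, Matrix.of_apply, List.take_succ_eq_append_getElem ht, List.mem_append,
    Bool.decide_or, Bool.not_or, Bool.and_assoc]

theorem apply_reset_nil {n : ℕ} (X : BMat n) : Op.apply X (.resetOp []) = X := by
  ext x y
  simp [Op.apply]

theorem resetOp_spec {s : Store} {n : ℕ} {X : BMat n} (hw : Fits n w) (h : Rep X s)
    {D : List (Fin n × Fin n)} (hD : D.Nodup) (hDX : ∀ p ∈ D, X p.1 p.2 = true) :
    Halts w (Op.resetOp D).args resetCode s fun s' t =>
      Rep (Op.apply X (.resetOp D)) s' ∧ t + s'.work.potential n ≤ s.work.potential n + 20 := by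
  have hlen := length_le_of_nodup hD
  have hin := hw.input_lt
  have hlt := hw.lt
  have hc : ∀ c ≤ 4, c % 2 ^ w = c := fun c => hw.lit
  have hlm : D.length % 2 ^ w = D.length := Nat.mod_eq_of_lt (by omega)
  refine .seq (.assign (.seq (.assign (.seq ((Halts.loop
    (fun s' => s'.var 1 = n ∧ s'.var 2 ≤ D.length ∧
      Inv (Op.apply X (.resetOp (D.take (s'.var 2)))) (fun _ _ _ => False) s'.work)
    (fun s' => s'.work.potential n) ?_ _ ?_).mono ?_)))))
  · rintro s' ⟨v1, h2, hI⟩ hlt2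
    have ht : s'.var 2 < D.length := by
      simpa [Expr.eval, Op.args, hc 1 (by norm_num), hlm] using hlt2
    set t := s'.var 2 with htdef
    set p := D[t] with hp
    have hXp : Op.apply X (.resetOp (D.take t)) p.1 p.2 = true := by
      -- without repetitions in the list, the entry is still true when its turn comes
      have h1 : p ∉ D.take t := by
        intro hmem
        obtain ⟨t', ht', he⟩ := List.mem_take_iff_getElem.1 hmem
        have := (List.Nodup.getElem_inj_iff hD).1 he
        omega
      simp [Op.apply, hDX p (List.getElem_mem _), h1]
    have e5 : ∀ s'' : Store, s''.var 2 = t →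
        Expr.eval w (Op.resetOp D).args s'' (.input (.add (.mul (.lit 2) (.var 2)) (.lit 2)))
          = p.1 := by
      intro s'' v2
      simp only [Expr.eval, v2, hc 2 (by norm_num), Nat.mod_add_mod]
      rw [Nat.mod_eq_of_lt (a := 2 * t + 2) (by omega)]
      simp only [Op.args, List.getD_cons_succ, (flatMap_getD D t ht).1]
      exact Nat.mod_eq_of_lt (by have := p.1.2; omega)
    have e6 : ∀ s'' : Store, s''.var 2 = t →
        Expr.eval w (Op.resetOp D).args s'' (.input (.add (.mul (.lit 2) (.var 2)) (.lit 3)))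
          = p.2 := by
      intro s'' v2
      simp only [Expr.eval, v2, hc 2 (by norm_num), hc 3 (by norm_num), Nat.mod_add_mod]
      rw [Nat.mod_eq_of_lt (a := 2 * t + 3) (by omega)]
      simp only [Op.args, List.getD_cons_succ, (flatMap_getD D t ht).2]
      exact Nat.mod_eq_of_lt (by have := p.2.2; omega)
    have ha : addr n 0 p.1 p.2 < size n := addr_lt_size (Nat.zero_le _) p.1.2 p.2.2
    have hval : s'.work.val (addr n 0 p.1 p.2) = 1 := by rw [hI.base, hXp]; rfl
    have htop : s'.var 3 + 1 ≤ size n := hI.top_lt ha hval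
    refine .seq (.assign (.seq (.assign (.seq (.assign ?_)))))
    rw [e5 _ htdef.symm, e6 _ (by simp [htdef]), eval_addrE (k := 0) (i := p.1) (j := p.2)
      (by simpa) (by simp [Expr.eval]) (by simp [Expr.eval]) (by simp [Expr.eval])
      (ha.trans hw.size_lt)]
    refine .seq ((clearCode_spec (a := addr n 0 p.1 p.2) hw (by simpa) (by simp)).mono ?_)
    rintro s₁ t₁ ⟨hw₁, hv₁, rfl⟩
    have u2 : s₁.var 2 = t := by rw [hv₁ 2 (by norm_num)]; simp [htdef]
    refine .assign ?_
    rw [eval_succ u2 (by omega)]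
    have hwork : (s₁.setVar 2 (t + 1)).work = s'.work.clear (addr n 0 p.1 p.2) := by
      rw [Store.work_setVar _ _ (by norm_num), hw₁, Store.work_setVar _ _ (by norm_num),
        Store.work_setVar _ _ (by norm_num), Store.work_setVar _ _ (by norm_num)]
    refine ⟨⟨?_, ?_, ?_⟩, ?_⟩
    · simp [hv₁, v1]
    · simp only [Store.setVar_var, if_true]
      omega
    · rw [hwork]
      simp only [Store.setVar_var, if_true]
      rw [← apply_reset_take_succ X D t ht]
      exact hI.clear_base hXp
    · rw [hwork]
      have h1 := Work.pot_clear (entryCost n) (popCost n) ha hval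
      -- the surplus of an entry over its processing cost pays for this iteration
      have h2 : entryCost n (addr n 0 p.1 p.2) = popCost n (addr n 0 p.1 p.2) + 100 := rfl
      simp only [Work.potential, Expr.cost, addrE] at h1 ⊢
      omega
  · refine ⟨?_, by simp [Expr.eval], ?_⟩
    · simp [Expr.eval, Op.args, Nat.mod_eq_of_lt (show n < 2 ^ w by omega)]
    · rw [Store.work_setVar _ _ (by norm_num), Store.work_setVar _ _ (by norm_num)]
      simpa [Expr.eval, apply_reset_nil] using h.inv
  · rintro s₁ t₁ ⟨⟨v1, h2, hI⟩, he, ht₁⟩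
    have h2' : D.length ≤ s₁.var 2 := by
      simpa [Expr.eval, Op.args, hc 1 (by norm_num), hlm] using he
    rw [List.take_of_length_le h2'] at hI
    refine (drainCode_spec hw hI v1).mono ?_
    rintro s₂ t₂ ⟨hI₂, v3, ht₂⟩
    refine ⟨⟨v3, hI₂⟩, ?_⟩
    rw [Store.work_setVar _ _ (by norm_num), Store.work_setVar _ _ (by norm_num)] at ht₁
    simp only [Expr.cost] at ht₁ ⊢
    omega

theorem lookupOp_spec {s : Store} {n : ℕ} {X : BMat n} (hw : Fits n w) (h : Rep X s)
    (x y : Fin n) :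
    Halts w (Op.lookupOp x y).args lookupCode s fun s' t =>
      Rep X s' ∧ s'.work = s.work ∧ t ≤ 40 ∧
        (InClosure X x y → s'.var 0 = 1) ∧ (¬ InClosure X x y → s'.var 0 = 0) := by
  have hlt := hw.lt
  have hsz := hw.size_lt
  have hc : ∀ c ≤ 4, c % 2 ^ w = c := fun c => hw.lit
  have hx : (x : ℕ) % 2 ^ w = x := Nat.mod_eq_of_lt (by have := x.2; omega)
  have hy : (y : ℕ) % 2 ^ w = y := Nat.mod_eq_of_lt (by have := y.2; omega)
  have hnm : n % 2 ^ w = n := Nat.mod_eq_of_lt (by omega)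
  have ha : addr n n x y < size n := addr_lt_size le_rfl x.2 y.2
  have hcl := closure_iff h.inv h.top x y
  have i1 : ∀ s' : Store, Expr.eval w (Op.lookupOp x y).args s' (.input (.lit 1)) = x := by
    intro s'; simp [Expr.eval, Op.args, hc, hx]
  have i2 : ∀ s' : Store, Expr.eval w (Op.lookupOp x y).args s' (.input (.lit 2)) = y := by
    intro s'; simp [Expr.eval, Op.args, hc, hy]
  have hrep : ∀ u v : ℕ, ((s.setVar 1 u).setVar 0 v).work = s.work := by
    intro u v
    rw [Store.work_setVar _ _ (by norm_num), Store.work_setVar _ _ (by norm_num)]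
  refine .seq (.assign (.cond ?_ ?_))
  · intro he
    have hxy : x = y := by
      rw [ne_eq, Expr.eval_eq_eq_zero, i1, i2, not_not] at he
      exact Fin.ext he
    refine .assign ⟨⟨by simpa using h.top, by rw [hrep]; exact h.inv⟩, hrep _ _, ?_, ?_, ?_⟩
    · simp [Expr.cost]
    · intro _; simp [Expr.eval, hc]
    · intro hn; exact absurd (hcl.2 (Or.inl hxy)) hn
  · intro he
    have hxy : x ≠ y := by
      rintro rfl
      rw [Expr.eval_eq_eq_zero, i1, i2] at he
      exact he rfl
    have hv : Expr.eval w (Op.lookupOp x y).args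
        (s.setVar 1 (Expr.eval w (Op.lookupOp x y).args s (.input (.lit 0))))
        (.read 0 (addrE (.var 1) (.input (.lit 1)) (.input (.lit 2))))
        = s.work.val (addr n n x y) := by
      rw [Expr.eval, eval_addrE (n := n) (k := n) _ _ (i1 _) (i2 _) (ha.trans hsz)]
      · rfl
      · simp [Expr.eval, Op.args, hnm]
      · simp [Expr.eval, Op.args, hnm]
    refine .assign ⟨⟨by simpa using h.top, by rw [hrep]; exact h.inv⟩, hrep _ _, ?_, ?_, ?_⟩
    · simp [Expr.cost, addrE]
    · intro hin
      have h1 := h.inv.le_one _ ha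
      have h2 := (hcl.1 hin).resolve_left hxy
      rw [hv]
      simp only [Store.setVar_var, if_true]
      omega
    · intro hin
      rw [hv]
      simp only [Store.setVar_var, if_true]
      by_contra h0
      exact hin (hcl.2 (Or.inr h0))

/-! ### Sequences of operations -/

/-- The cost of one operation, apart from the exchange with the potential, and its answer. -/
def StepOK {n : ℕ} (X : BMat n) (s s' : Store) (t : ℕ) : Op n → Prop
  | .initOp _ => t + s'.work.potential n ≤ 2000 * size n
  | .setOp _ _ => True
  | .resetOp _ => t + s'.work.potential n ≤ s.work.potential n + 20
  | .lookupOp x y => s'.work = s.work ∧ t ≤ 40 ∧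
      (InClosure X x y → s'.var 0 = 1) ∧ (¬ InClosure X x y → s'.var 0 = 0)

/-- Legality of a sequence of operations that starts with the matrix `X`. -/
def LegalFrom {n : ℕ} (X : BMat n) (σ : List (Op n)) : Prop :=
  ∀ (j : ℕ) (D : List (Fin n × Fin n)), σ[j]? = some (.resetOp D) →
    D.Nodup ∧ ∀ p ∈ D, (σ.take j).foldl Op.apply X p.1 p.2 = true

theorem LegalFrom.tail {n : ℕ} {X : BMat n} {o : Op n} {σ : List (Op n)}
    (h : LegalFrom X (o :: σ)) : LegalFrom (Op.apply X o) σ :=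
  fun j D hj => h (j + 1) D (by simpa using hj)

theorem op_spec {n : ℕ} {X : BMat n} {s : Store} {o : Op n} {σ : List (Op n)} (hw : Fits n w)
    (h : Rep X s) (hl : LegalFrom X (o :: σ)) :
    Halts w o.args (warshall.code o) s fun s' t => Rep (Op.apply X o) s' ∧ StepOK X s s' t o := by
  cases o with
  | initOp Y => exact initOp_spec hw h Y
  | setOp i D => exact (setOp_spec hw h i D).mono fun _ _ h => ⟨h, trivial⟩
  | resetOp D =>
    have := hl 0 D rfl
    exact resetOp_spec hw h this.1 this.2
  | lookupOp x y => exact lookupOp_spec hw h x y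

theorem run_exists {n : ℕ} (hw : Fits n w) (σ : List (Op n)) : ∀ {X : BMat n} {s : Store},
    Rep X s → LegalFrom X σ → ∃ r, Run warshall w s σ r := by
  induction σ with
  | nil => exact fun _ _ => ⟨_, .nil _⟩
  | cons o σ ih =>
    intro X s h hl
    obtain ⟨s', t, he, hR, -⟩ := op_spec hw h hl
    obtain ⟨r, hr⟩ := ih hR hl.tail
    exact ⟨_, .cons he hr⟩

theorem run_correct {n : ℕ} (hw : Fits n w) (σ : List (Op n)) :
    ∀ {X : BMat n} {s : Store} {r : List (ℕ × ℕ)}, Rep X s → LegalFrom X σ →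
      Run warshall w s σ r → ∀ (j : ℕ) (x y : Fin n), σ[j]? = some (.lookupOp x y) →
        ∃ t b : ℕ, r[j]? = some (t, b) ∧ t ≤ 40 ∧
          (InClosure ((σ.take j).foldl Op.apply X) x y → b = 1) ∧
          (¬ InClosure ((σ.take j).foldl Op.apply X) x y → b = 0) := by
  induction σ with
  | nil => intro X s r _ _ _ j x y hj; simp at hj
  | cons o σ ih =>
    intro X s r h hl hr j x y hj
    obtain ⟨s', t, he, hR, hok⟩ := op_spec hw h hl
    cases hr with
    | cons he' hr' =>
      obtain ⟨rfl, rfl⟩ := he.det he'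
      cases j with
      | zero =>
        obtain rfl : o = .lookupOp x y := by simpa using hj
        exact ⟨_, _, rfl, hok.2.1, hok.2.2⟩
      | succ j => simpa using ih hR hl.tail hr' j x y (by simpa using hj)

/-- Since every operation other than `Init*` is paid for by the potential up to a constant, the
total time is bounded by the number of `Reset*` operations and the cost of all rebuilding. -/
theorem run_time {n : ℕ} (hw : Fits n w) (σ : List (Op n)) :
    ∀ {X : BMat n} {s : Store} {r : List (ℕ × ℕ)}, Rep X s → LegalFrom X σ →
      σ.countP Op.isSet = 0 → Run warshall w s σ r →
        updateTime σ r ≤ s.work.potential n + 2000 * size n * σ.countP Op.isInit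
          + 20 * σ.countP Op.isReset := by
  induction σ with
  | nil => intro X s r _ _ _ _; simp [updateTime]
  | cons o σ ih =>
    intro X s r h hl hset hr
    obtain ⟨s', t, he, hR, hok⟩ := op_spec hw h hl
    cases hr with
    | cons he' hr' =>
      obtain ⟨rfl, rfl⟩ := he.det he'
      have hset' : σ.countP Op.isSet = 0 := by
        rw [List.countP_cons] at hset; omega
      have ih := ih hR hl.tail hset' hr'
      have hu : ∀ (t b : ℕ) (r : List (ℕ × ℕ)), updateTime (o :: σ) ((t, b) :: r)
          = (if o.isLookup then 0 else t) + updateTime σ r := by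
        intro t b r; simp [updateTime]
      rw [hu, List.countP_cons, List.countP_cons]
      cases o with
      | initOp Y =>
        simp only [StepOK] at hok
        simp only [Op.isLookup, Op.isInit, Op.isReset, Bool.false_eq_true, if_true, if_false,
          mul_add]
        omega
      | setOp i D => simp [Op.isSet] at hset
      | resetOp D =>
        simp only [StepOK] at hok
        simp only [Op.isLookup, Op.isInit, Op.isReset, Bool.false_eq_true, if_true, if_false,
          mul_add]
        omega
      | lookupOp x y =>
        obtain ⟨hwk, -⟩ := hok
        rw [hwk] at ih
        simp only [Op.isLookup, Op.isInit, Op.isReset, Bool.false_eq_true, if_true, if_false,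
          mul_add]
        omega

theorem rep_zero (n : ℕ) : Rep (Matrix.of fun _ _ => false : BMat n) Store.zero where
  top := rfl
  inv :=
    { le_one := fun _ _ => Nat.zero_le _
      count := by simp [Work.pot, Store.work, Store.zero]
      stack_lt := fun t ht => by simp [Store.work, Store.zero] at ht
      base := fun _ _ => rfl
      upper := fun k _ i _ j _ h => by simp [Support, Store.work, Store.zero] at h
      lower := fun k _ i _ j _ h => absurd rfl h }

theorem potential_zero (n : ℕ) : Store.zero.work.potential n = 0 := by
  simp [Work.potential, Work.pot, Store.work, Store.zero]

theorem fits_of_pow_le {n : ℕ} (hn : 1 ≤ n) (h : (n + 2) ^ 4 ≤ 2 ^ w) : Fits n w := by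
  have e : (n + 2) ^ 4 = n * (n * (n * n)) + 8 * (n * (n * n)) + 24 * (n * n) + 32 * n + 16 := by
    ring
  refine ⟨hn, ?_, ?_⟩
  · rw [size_eq]; omega
  · omega

end DynClosure

theorem mainTheorem3 :
    ∃ (P : DynClosure.DataStructure) (k K : ℕ),
      -- every legal sequence is answered correctly, each query in constant time
      (∀ (n w : ℕ), 1 ≤ n → (n + 2) ^ k ≤ 2 ^ w →
        ∀ σ : List (DynClosure.Op n), DynClosure.Legal σ →
          (∃ r, DynClosure.Run P w DynClosure.Store.zero σ r) ∧
          ∀ r, DynClosure.Run P w DynClosure.Store.zero σ r →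
            ∀ (j : ℕ) (x y : Fin n), σ[j]? = some (.lookupOp x y) →
              ∃ t b : ℕ, r[j]? = some (t, b) ∧ t ≤ K ∧
                (DynClosure.InClosure (DynClosure.matrixAfter (σ.take j)) x y → b = 1) ∧
                (¬ DynClosure.InClosure (DynClosure.matrixAfter (σ.take j)) x y → b = 0)) ∧
      -- amortized time of deletions
      (∀ c : ℝ, 0 < c → ∃ C : ℝ,
        ∀ (n w : ℕ), 1 ≤ n → (n + 2) ^ k ≤ 2 ^ w →
          ∀ σ : List (DynClosure.Op n), DynClosure.Legal σ →
            σ.countP DynClosure.Op.isSet = 0 →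
            c * (n : ℝ) ^ 2 * (σ.countP DynClosure.Op.isInit : ℝ)
              ≤ (σ.countP DynClosure.Op.isReset : ℝ) →
            ∀ r, DynClosure.Run P w DynClosure.Store.zero σ r →
              (DynClosure.updateTime σ r : ℝ)
                ≤ C * (n : ℝ) * (σ.countP DynClosure.Op.isReset : ℝ)) := by
  -- words of `4 * log (n + 2)` bits hold the addresses, which are below `(n + 1) * n ^ 2`
  refine ⟨DynClosure.warshall, 4, 40, ?_, ?_⟩
  · intro n w hn hw σ hσ
    have hfit := DynClosure.fits_of_pow_le hn hw
    exact ⟨DynClosure.run_exists hfit σ (DynClosure.rep_zero n) hσ,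
      fun r hr => DynClosure.run_correct hfit σ (DynClosure.rep_zero n) hσ hr⟩
  · intro c hc
    refine ⟨4000 / c + 20, fun n w hn hw σ hσ hset hIR r hr => ?_⟩
    have hfit := DynClosure.fits_of_pow_le hn hw
    have ht := DynClosure.run_time hfit σ (DynClosure.rep_zero n) hσ hset hr
    rw [DynClosure.potential_zero, Nat.zero_add] at ht
    have ht : (DynClosure.updateTime σ r : ℝ) ≤ 2000 * ((n + 1) * n * n)
        * (σ.countP DynClosure.Op.isInit : ℝ) + 20 * (σ.countP DynClosure.Op.isReset : ℝ) := by
      have := (Nat.cast_le (α := ℝ)).2 ht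
      push_cast [DynClosure.size] at this
      exact this
    have hI : (0 : ℝ) ≤ (σ.countP DynClosure.Op.isInit : ℝ) := Nat.cast_nonneg _
    generalize (σ.countP DynClosure.Op.isInit : ℝ) = I at *
    have hR : (0 : ℝ) ≤ (σ.countP DynClosure.Op.isReset : ℝ) := Nat.cast_nonneg _
    generalize (σ.countP DynClosure.Op.isReset : ℝ) = R at *
    have hn' : (1 : ℝ) ≤ n := by exact_mod_cast hn
    -- the rebuilding cost of one `Init*` is `O(n ^ 3)`, which is `n / c` times its share of `R`
    have h1 : (n : ℝ) ^ 2 * I ≤ R / c := by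
      rw [le_div_iff₀ hc]
      linarith
    have h2 : 2000 * (((n : ℝ) + 1) * n * n) * I ≤ 4000 * n * ((n : ℝ) ^ 2 * I) := by
      have : 0 ≤ 2000 * ((n : ℝ) ^ 2 * I) * (n - 1) :=
        mul_nonneg (by positivity) (by linarith)
      linarith
    have h3 : 4000 * (n : ℝ) * ((n : ℝ) ^ 2 * I) ≤ 4000 * n * (R / c) :=
      mul_le_mul_of_nonneg_left h1 (by positivity)
    have h4 : 20 * R ≤ 20 * n * R := by
      have : 0 ≤ 20 * R * ((n : ℝ) - 1) := mul_nonneg (by positivity) (by linarith)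
      linarith
    calc (DynClosure.updateTime σ r : ℝ) ≤ 4000 * n * (R / c) + 20 * n * R := by linarith
      _ = (4000 / c + 20) * n * R := by ring
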